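/- Let $K$ be a field, $\theta$ an automorphism of $K$ of finite order $r\ge 1$, and $F=\{a\in K:\theta(a)=a\}$. Let $\mathcal A=K[X^{\pm1};\theta]$ be the ring of skew Laurent polynomials ($Xa=\theta(a)X$ for $a\in K$), put $Y=X^r$, and let $\mathrm{Frac}(\mathcal A)$ be its field of fractions, that is, the ring of fractions $D^{-1}g$ with $g\in\mathcal A$ and $0\ne D\in F[Y]$. Let $F^{\mathrm s}$ be a separable closure of $F$. For $z\in F^{\mathrm s}$, $z\neq0$, with minimal polynomial $N\in F[Y]$ over $F$, a $z$-admissible morphism is a homomorphism of $K$-algebras $\tau_z:\varprojlim_m\mathcal A/N^m\mathcal A\to(\mathcal A/N\mathcal A)[[T]]$ such that $\tau_z(X)\equiv X\pmod T$ and $\tau_z(Y)=z+T$, where $z$ on the right is the class of $Y$ in $\mathcal A/N\mathcal A$. It induces a ring homomorphism $\mathrm{TS}_z:\mathrm{Frac}(\mathcal A)\to(\mathcal A/N\mathcal A)((T))$. For $f\in\mathrm{Frac}(\mathcal A)$ the $0$-th partial skew residues, all viewed in $K\otimes_FF^{\mathrm s}$ (with $c\in K$ identified with $c\otimes1$), are: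 - for $z\in F^{\mathrm s}$, $z\ne0$: $\mathrm{sres}_{z,0}(f)=\iota_z\big(\sec_0(\text{coefficient of }T^{-1}\text{ in }\mathrm{TS}_z(f))\big)$, where $\sec_0:\mathcal A/N\mathcal A\to K[Y^{\pm1}]/N$ is induced by $\sum_n a_nX^n\mapsto\sum_i a_{ir}Y^i$ and $\iota_z:K[Y^{\pm1}]/N\to K\otimes_FF^{\mathrm s}$ is given by $aY^i\mapsto a\otimes z^i$; - $\mathrm{sres}_{0,0}(f)$ is the coefficient of $X^{-r}$ in the expansion of $f$ in the ring of skew Laurent series $K((X;\theta))$; - $\mathrm{sres}_{\infty,0}(f)$ is the opposite of the coefficient of $\tilde X^{r}$ in the expansion of $f$ in $K((\tilde X;\theta^{-1}))$, where $\tilde X=X^{-1}$. Then a $z$-admissible morphism exists for every nonzero $z\in F^{\mathrm s}$. Moreover, for every choice of such morphisms and for every $f\in\mathrm{Frac}(\mathcal A)$ all of whose finite poles lie in $F^{\mathrm s}$ (that is, $Df\in\mathcal A$ for some nonzero $D\in F[Y]$ which splits into linear factors over $F^{\mathrm s}$; this holds for every $f$ when $F$ is perfect), only finitely many of the $\mathrm{sres}_{z,0}(f)$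 are nonzero, and $$\sum_{z\in F^{\mathrm s}\sqcup\{\infty\}}\mathrm{sres}_{z,0}(f)=0.$$ -/

import Mathlib

open scoped Polynomial LaurentPolynomial TensorProduct OnePoint

noncomputable section

namespace SkewResidue

variable {K : Type*} [Field K]

/-- The subfield `F` of `K` fixed by `θ`. -/
abbrev fixedField (θ : RingAut K) : Subfield K :=
  (θ : K →+* K).eqLocusField (RingHom.id K)

/-- The action of `ℤ` on `K` through the powers of `θ`. -/
abbrev powAction (θ : RingAut K) : MulSemiringAction (Multiplicative ℤ) K :=
  MulSemiringAction.compHom K (zpowersHom (RingAut K) θ)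

/-- The ring `𝒜 = K[X^{±1}; θ]` of skew Laurent polynomials: finite sums `∑ aᵢ Xⁱ` (`i ∈ ℤ`) with
`(a Xⁱ) (b Xʲ) = a θⁱ(b) Xⁱ⁺ʲ`. -/
def SkewLaurent (_ : RingAut K) : Type _ := SkewMonoidAlgebra K (Multiplicative ℤ)

namespace SkewLaurent

variable (θ : RingAut K)

instance : Ring (SkewLaurent θ) :=
  letI := powAction θ
  inferInstanceAs (Ring (SkewMonoidAlgebra K (Multiplicative ℤ)))

/-- The coefficient of `Xⁿ` (coefficients are written on the left). -/
def coeff (n : ℤ) : SkewLaurent θ →+ K where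
  toFun f := SkewMonoidAlgebra.coeff f (Multiplicative.ofAdd n)
  map_zero' := rfl
  map_add' f g := DFunLike.congr_fun (SkewMonoidAlgebra.coeff_add f g) _

/-- The monomial `a Xⁿ`. -/
def monomial (n : ℤ) : K →+ SkewLaurent θ where
  toFun a := (SkewMonoidAlgebra.single (Multiplicative.ofAdd n) a :)
  map_zero' := SkewMonoidAlgebra.single_zero _
  map_add' := SkewMonoidAlgebra.single_add _

theorem monomial_mul_monomial (m n : ℤ) (a b : K) :
    monomial θ m a * monomial θ n b = monomial θ (m + n) (a * (θ ^ m) b) :=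
  letI := powAction θ
  SkewMonoidAlgebra.single_mul_single

theorem one_def : (1 : SkewLaurent θ) = monomial θ 0 1 := rfl

theorem coeff_monomial (m n : ℤ) (a : K) :
    coeff θ m (monomial θ n a) = if n = m then a else 0 := by
  classical
  refine (SkewMonoidAlgebra.coeff_single_apply (a := Multiplicative.ofAdd n)
    (a' := Multiplicative.ofAdd m)).trans ?_
  simp

theorem induction_on {P : SkewLaurent θ → Prop} (f : SkewLaurent θ)
    (h0 : P 0) (hm : ∀ n a, P (monomial θ n a)) (ha : ∀ f g, P f → P g → P (f + g)) : P f :=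
  SkewMonoidAlgebra.induction_on (p := P) f h0 (fun n a => hm n.toAdd a) (fun f g => ha f g)

/-- Constants, `K → 𝒜`. -/
def C : K →+* SkewLaurent θ where
  toFun a := monomial θ 0 a
  map_zero' := map_zero _
  map_one' := rfl
  map_add' := map_add _
  map_mul' a b := by rw [monomial_mul_monomial]; simp

/-- The variable `X`. -/
def X : SkewLaurent θ := monomial θ 1 1

theorem X_pow (n : ℕ) : X θ ^ n = monomial θ n 1 := by
  induction n with
  | zero => rfl
  | succ n ih => rw [pow_succ, ih, X, monomial_mul_monomial]; simp

/-- The ring homomorphism `𝒜 → R` which is `φ` on `K` and sends `X` to the unit `x`, when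
`x φ(a) = φ(θ(a)) x` for all `a ∈ K`. -/
def lift {R : Type*} [Ring R] (φ : K →+* R) (x : Rˣ)
    (h : ∀ a, (x : R) * φ a = φ (θ a) * x) : SkewLaurent θ →+* R :=
  letI := powAction θ
  SkewMonoidAlgebra.liftNCRingHom φ ((Units.coeHom R).comp (zpowersHom Rˣ x)) (by
    have key : ∀ n : ℤ, ∀ a, φ ((θ ^ n) a) * ((x ^ n : Rˣ) : R) = ((x ^ n : Rˣ) : R) * φ a := by
      have hinv : ∀ a, ((x⁻¹ : Rˣ) : R) * φ a = φ ((θ⁻¹ : RingAut K) a) * ((x⁻¹ : Rˣ) : R) := by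
        intro a
        rw [Units.inv_mul_eq_iff_eq_mul, ← mul_assoc, Units.eq_mul_inv_iff_mul_eq, h]
        rw [← RingAut.mul_apply, mul_inv_cancel, RingAut.one_apply]
      intro n
      induction n with
      | zero => simp
      | succ n ih =>
        intro a
        rw [zpow_add_one, zpow_add_one, RingAut.mul_apply, Units.val_mul, ← mul_assoc, ih,
          mul_assoc, ← h, mul_assoc]
      | pred n ih =>
        intro a
        rw [zpow_sub_one, zpow_sub_one, RingAut.mul_apply, Units.val_mul, ← mul_assoc, ih,
          mul_assoc, ← hinv, mul_assoc]
    intro a n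
    exact key n.toAdd a)

theorem lift_monomial {R : Type*} [Ring R] (φ : K →+* R) (x : Rˣ)
    (h : ∀ a, (x : R) * φ a = φ (θ a) * x) (n : ℤ) (a : K) :
    lift θ φ x h (monomial θ n a) = φ a * ((x ^ n : Rˣ) : R) := by
  let := powAction θ
  exact SkewMonoidAlgebra.liftNC_single _ _ _ _

end SkewLaurent

open SkewLaurent

variable (θ : RingAut K)

/-- The homomorphism `𝒵⁺ = F[Y] → 𝒜`, `Y ↦ X^r`, where `r` is the order of `θ`. -/
def ofCenter : (fixedField θ)[X] →+* SkewLaurent θ :=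
  Polynomial.eval₂RingHom' ((SkewLaurent.C θ).comp (fixedField θ).subtype)
    (SkewLaurent.X θ ^ orderOf θ) (fun a => by
      rw [X_pow]
      change monomial θ 0 (a : K) * _ = _ * monomial θ 0 (a : K)
      rw [monomial_mul_monomial, monomial_mul_monomial]
      simp [pow_orderOf_eq_one])

theorem ofCenter_monomial (n : ℕ) (a : fixedField θ) :
    ofCenter θ (Polynomial.monomial n a) = monomial θ ((orderOf θ : ℤ) * n) (a : K) := by
  change Polynomial.eval₂ _ _ _ = _
  rw [Polynomial.eval₂_monomial, ← pow_mul, X_pow]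
  change monomial θ 0 (a : K) * _ = _
  rw [monomial_mul_monomial]
  simp

theorem ofCenter_commute (p : (fixedField θ)[X]) (f : SkewLaurent θ) :
    Commute (ofCenter θ p) f := by
  induction p using Polynomial.induction_on' with
  | add p q hp hq => rw [map_add]; exact hp.add_left hq
  | monomial n a =>
    rw [ofCenter_monomial]
    induction f using SkewLaurent.induction_on with
    | h0 => exact Commute.zero_right _
    | ha f g hf hg => exact hf.add_right hg
    | hm m b =>
      have ha : ∀ k : ℤ, (θ ^ k) (a : K) = a := by
        have h1 : θ (a : K) = a := a.2
        have h2 : (θ⁻¹ : RingAut K) (a : K) = a := by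
          conv_lhs => rw [← h1]
          rw [← RingAut.mul_apply, inv_mul_cancel, RingAut.one_apply]
        intro k
        induction k with
        | zero => rfl
        | succ n ih => rw [zpow_add_one, RingAut.mul_apply, h1, ih]
        | pred n ih => rw [zpow_sub_one, RingAut.mul_apply, h2, ih]
      change _ * _ = _ * _
      rw [monomial_mul_monomial, monomial_mul_monomial, ha, zpow_mul, zpow_natCast,
        zpow_natCast, pow_orderOf_eq_one, one_pow, RingAut.one_apply, mul_comm b, add_comm]

/-! ### The fraction field -/

/-- The multiplicative set of the nonzero elements of `𝒵⁺ = F[Y]`, in `𝒜`. -/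
def denominators : Submonoid (SkewLaurent θ) :=
  (nonZeroDivisors (fixedField θ)[X]).map (ofCenter θ)

instance : OreLocalization.OreSet (denominators θ) where
  ore_right_cancel a b s h := by
    obtain ⟨_, p, _, rfl⟩ := s
    refine ⟨⟨_, p, ‹_›, rfl⟩, ?_⟩
    have h1 := ofCenter_commute θ p a
    have h2 := ofCenter_commute θ p b
    exact h1.eq.trans (h.trans h2.eq.symm)
  oreNum a _ := a
  oreDenom _ s := s
  ore_eq a s := by
    obtain ⟨_, p, _, rfl⟩ := s
    exact ofCenter_commute θ p a

/-- `Frac(𝒜) = Frac(𝒵) ⊗ 𝒜`: the fractions `D⁻¹ g` with `g ∈ 𝒜` and `0 ≠ D ∈ F[Y]`. -/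
abbrev SkewFrac : Type _ := OreLocalization (denominators θ) (SkewLaurent θ)

/-- The inclusion `𝒜 → Frac(𝒜)`. -/
def toFrac : SkewLaurent θ →+* SkewFrac θ := OreLocalization.numeratorRingHom

variable {θ} in
/-- The extension to `Frac(𝒜)` of a ring homomorphism defined on `𝒜` which sends nonzero elements of
`F[Y]` to units: `D⁻¹ g ↦ φ(D)⁻¹ φ(g)`. -/
def fracLift {R : Type*} [Ring R] (φ : SkewLaurent θ →+* R)
    (h : ∀ D : (fixedField θ)[X], D ≠ 0 → IsUnit (φ (ofCenter θ D))) : SkewFrac θ →+* R :=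
  OreLocalization.universalHom φ
    (IsUnit.liftRight ((φ : SkewLaurent θ →* R).comp (denominators θ).subtype) (by
      rintro ⟨_, p, hp, rfl⟩
      exact h p (nonZeroDivisors.ne_zero hp)))
    (fun _ => rfl)

variable {θ} in
theorem fracLift_toFrac {R : Type*} [Ring R] (φ : SkewLaurent θ →+* R)
    (h : ∀ D : (fixedField θ)[X], D ≠ 0 → IsUnit (φ (ofCenter θ D))) (f : SkewLaurent θ) :
    fracLift φ h (toFrac θ f) = φ f :=
  OreLocalization.universalHom_commutes _ _ _

/-- A homomorphism from power series over a field which inverts the variable inverts every nonzero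
power series. -/
theorem isUnit_map_powerSeries {E R : Type*} [Field E] [Ring R] (ψ : PowerSeries E →+* R)
    (hψ : IsUnit (ψ PowerSeries.X)) (q : PowerSeries E) (hq : q ≠ 0) : IsUnit (ψ q) := by
  have h : q = (PowerSeries.X : PowerSeries E) ^ q.order.toNat *
      (PowerSeries.Unit_of_divided_by_X_pow_order q : PowerSeries E) := by
    rw [PowerSeries.Unit_of_divided_by_X_pow_order_nonzero hq]
    exact PowerSeries.X_pow_order_mul_divXPowOrder.symm
  rw [h, map_mul, map_pow]
  exact (hψ.pow _).mul ((Units.isUnit _).map ψ)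

/-! ### Skew Laurent series -/

/-- An automorphism of `K`, as an additive endomorphism of `K`. -/
def toEnd : RingAut K →* Module.End ℤ K where
  toFun σ := (σ : K →+ K).toIntLinearMap
  map_one' := rfl
  map_mul' _ _ := rfl

/-- Multiplication by `a`, as an additive endomorphism of `K`. -/
def mulEnd : K →+* Module.End ℤ K where
  toFun a := LinearMap.mulLeft ℤ a
  map_zero' := by ext; simp
  map_one' := by ext; simp
  map_add' a b := by ext; simp [add_mul]
  map_mul' a b := by ext; simp

theorem toEnd_mul_mulEnd (σ : RingAut K) (a : K) :
    toEnd σ * mulEnd a = mulEnd (σ a) * toEnd σ := by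
  ext x
  exact map_mul σ a x

/-- The ring `K((X; θ))` of skew Laurent series `∑ aᵢ Xⁱ`, in which `X a = θ(a) X`. The series
`∑ aᵢ Xⁱ` is represented by the Laurent series in a central variable with `i`-th coefficient the
additive endomorphism `x ↦ aᵢ θⁱ(x)` of `K`; indeed `(a θⁱ) ∘ (b θʲ) = a θⁱ(b) θⁱ⁺ʲ`. -/
def SkewLaurentSeries : Subring (LaurentSeries (Module.End ℤ K)) where
  carrier := {s | ∀ i : ℤ, ∃ a : K, s.coeff i = mulEnd a * toEnd (θ ^ i)}
  zero_mem' i := ⟨0, by simp⟩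
  one_mem' i := by
    by_cases hi : i = 0
    · subst hi; exact ⟨1, by simp⟩
    · exact ⟨0, by simp [HahnSeries.coeff_one, hi]⟩
  add_mem' {s t} hs ht i := by
    obtain ⟨a, ha⟩ := hs i
    obtain ⟨b, hb⟩ := ht i
    exact ⟨a + b, by rw [HahnSeries.coeff_add, ha, hb, map_add, add_mul]⟩
  neg_mem' {s} hs i := by
    obtain ⟨a, ha⟩ := hs i
    exact ⟨-a, by rw [HahnSeries.coeff_neg, ha, map_neg, neg_mul]⟩
  mul_mem' {s t} hs ht i := by
    choose a ha using hs
    choose b hb using ht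
    refine ⟨∑ ij ∈ Finset.antidiagonal s.isPWO_support t.isPWO_support i,
      a ij.1 * (θ ^ ij.1) (b ij.2), ?_⟩
    rw [HahnSeries.coeff_mul, map_sum, Finset.sum_mul]
    refine Finset.sum_congr rfl fun ij hij => ?_
    obtain ⟨-, -, rfl⟩ := Finset.mem_antidiagonal.1 hij
    rw [ha, hb, zpow_add, map_mul, map_mul, mul_assoc, ← mul_assoc (toEnd _) (mulEnd _),
      toEnd_mul_mulEnd, mul_assoc, mul_assoc]

/-- The coefficient `aᵢ` of `Xⁱ` in a skew Laurent series `∑ aᵢ Xⁱ`. -/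
def SkewLaurentSeries.coeff (i : ℤ) : SkewLaurentSeries θ →+ K where
  toFun s := (s : LaurentSeries (Module.End ℤ K)).coeff i 1
  map_zero' := rfl
  map_add' _ _ := rfl

/-- The unit `X` of `K((X; θ))`, viewed in the ambient ring of Laurent series. -/
def seriesX : (LaurentSeries (Module.End ℤ K))ˣ where
  val := HahnSeries.single 1 (toEnd θ)
  inv := HahnSeries.single (-1) (toEnd θ⁻¹)
  val_inv := by
    rw [HahnSeries.single_mul_single, ← map_mul, mul_inv_cancel, map_one]; rfl
  inv_val := by
    rw [HahnSeries.single_mul_single, ← map_mul, inv_mul_cancel, map_one]; rfl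

theorem seriesX_zpow (n : ℤ) :
    ((seriesX θ ^ n : (LaurentSeries (Module.End ℤ K))ˣ) : LaurentSeries (Module.End ℤ K)) =
      HahnSeries.single n (toEnd (θ ^ n)) := by
  induction n with
  | zero => rfl
  | succ n ih =>
    rw [zpow_add_one, Units.val_mul, ih]
    change _ * HahnSeries.single 1 (toEnd θ) = _
    rw [HahnSeries.single_mul_single, ← map_mul, zpow_add_one]
  | pred n ih =>
    rw [zpow_sub_one, Units.val_mul, ih]
    change _ * HahnSeries.single (-1) (toEnd θ⁻¹) = _
    rw [HahnSeries.single_mul_single, ← map_mul, zpow_sub_one]; rfl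

/-- The inclusion of `𝒜` in the ambient ring of Laurent series. -/
def toSeriesAux : SkewLaurent θ →+* LaurentSeries (Module.End ℤ K) :=
  SkewLaurent.lift θ (HahnSeries.C.comp mulEnd) (seriesX θ) (fun a => by
    change HahnSeries.single 1 (toEnd θ) * HahnSeries.single 0 (mulEnd a) =
      HahnSeries.single 0 (mulEnd (θ a)) * HahnSeries.single 1 (toEnd θ)
    rw [HahnSeries.single_mul_single, HahnSeries.single_mul_single, toEnd_mul_mulEnd]; rfl)

theorem toSeriesAux_monomial (n : ℤ) (a : K) :
    toSeriesAux θ (monomial θ n a) = HahnSeries.single n (mulEnd a * toEnd (θ ^ n)) := by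
  rw [toSeriesAux, lift_monomial, seriesX_zpow]
  change HahnSeries.single 0 (mulEnd a) * _ = _
  rw [HahnSeries.single_mul_single, zero_add]

theorem toSeriesAux_coeff (f : SkewLaurent θ) (i : ℤ) :
    (toSeriesAux θ f).coeff i = mulEnd (SkewLaurent.coeff θ i f) * toEnd (θ ^ i) := by
  induction f using SkewLaurent.induction_on with
  | h0 => simp
  | ha f g hf hg => rw [map_add, HahnSeries.coeff_add, hf, hg, map_add, map_add, add_mul]
  | hm n a =>
    rw [toSeriesAux_monomial, SkewLaurent.coeff_monomial]
    by_cases h : n = i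
    · subst h; simp
    · rw [HahnSeries.coeff_single_of_ne (Ne.symm h)]; simp [h]

/-- The inclusion `𝒜 → K((X; θ))`, which sends `∑ aᵢ Xⁱ` to `∑ aᵢ Xⁱ`. -/
def toSeries : SkewLaurent θ →+* SkewLaurentSeries θ :=
  (toSeriesAux θ).codRestrict (SkewLaurentSeries θ) (fun f i => ⟨_, toSeriesAux_coeff θ f i⟩)

theorem toSeries_coeff (f : SkewLaurent θ) (i : ℤ) :
    SkewLaurentSeries.coeff θ i (toSeries θ f) = SkewLaurent.coeff θ i f := by
  change (toSeriesAux θ f).coeff i 1 = _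
  rw [toSeriesAux_coeff]
  change SkewLaurent.coeff θ i f * (θ ^ i) 1 = _
  rw [map_one, mul_one]

/-- The homomorphism `F[[Y]] → K((X; θ))`, `Y ↦ X^n`, for a subfield `F` and an integer `n > 0` with
`θⁿ = 1`. -/
def ofPowerSeries (F : Subfield K) (n : ℕ) (hn : 0 < n) (hθ : θ ^ n = 1) :
    PowerSeries F →+* SkewLaurentSeries θ :=
  ((HahnSeries.embDomainRingHom ((AddMonoidHom.mulLeft (n : ℤ)).comp (Nat.castAddMonoidHom ℤ))
      (fun a b h => by simpa [hn.ne'] using h)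
      (fun a b => by simp [hn])).comp
    ((HahnSeries.toPowerSeries (R := Module.End ℤ K)).symm.toRingHom.comp
      (PowerSeries.map (mulEnd.comp F.subtype)))).codRestrict (SkewLaurentSeries θ) (by
    intro q i
    by_cases h : ∃ m : ℕ, (n : ℤ) * m = i
    · obtain ⟨m, rfl⟩ := h
      refine ⟨(PowerSeries.coeff m q : F), ?_⟩
      rw [zpow_mul, zpow_natCast, zpow_natCast, hθ, one_pow, map_one, mul_one]
      refine (HahnSeries.embDomain_coeff (a := m)).trans ?_
      simp
    · refine ⟨0, ?_⟩
      rw [map_zero, zero_mul]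
      refine HahnSeries.embDomain_of_notMem_range ?_
      rintro ⟨m, hm⟩
      exact h ⟨m, hm⟩)

theorem ofPowerSeries_monomial (F : Subfield K) (n : ℕ) (hn : 0 < n) (hθ : θ ^ n = 1)
    (m : ℕ) (a : F) :
    ofPowerSeries θ F n hn hθ (PowerSeries.monomial m a) =
      toSeries θ (monomial θ ((n : ℤ) * m) (a : K)) := by
  apply Subtype.ext
  change _ = toSeriesAux θ _
  rw [toSeriesAux_monomial, zpow_mul, zpow_natCast, zpow_natCast, hθ, one_pow, map_one, mul_one]
  have h : (HahnSeries.toPowerSeries (R := Module.End ℤ K)).symm.toRingHom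
      (PowerSeries.map (mulEnd.comp F.subtype) (PowerSeries.monomial m a)) =
      HahnSeries.single m (mulEnd (a : K)) := by
    ext1
    funext k
    rcases eq_or_ne k m with rfl | hk
    · simp
    · simp [HahnSeries.coeff_single_of_ne hk, PowerSeries.coeff_monomial, hk]
  change HahnSeries.embDomain _ ((HahnSeries.toPowerSeries (R := Module.End ℤ K)).symm.toRingHom
      (PowerSeries.map (mulEnd.comp F.subtype) (PowerSeries.monomial m a))) = _
  rw [h, HahnSeries.embDomain_single]
  rfl

theorem isUnit_toSeries_monomial (n : ℤ) : IsUnit (toSeries θ (monomial θ n 1)) := by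
  refine IsUnit.map (toSeries θ) ⟨⟨monomial θ n 1, monomial θ (-n) 1, ?_, ?_⟩, rfl⟩ <;>
  · rw [monomial_mul_monomial]
    simp [SkewLaurent.one_def]

theorem isUnit_ofPowerSeries (F : Subfield K) (n : ℕ) (hn : 0 < n) (hθ : θ ^ n = 1)
    (q : PowerSeries F) (hq : q ≠ 0) : IsUnit (ofPowerSeries θ F n hn hθ q) := by
  refine isUnit_map_powerSeries _ ?_ q hq
  rw [PowerSeries.X_eq, ofPowerSeries_monomial]
  exact isUnit_toSeries_monomial θ _

theorem isUnit_toSeries_ofCenter (hθ : IsOfFinOrder θ) (D : (fixedField θ)[X]) (hD : D ≠ 0) :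
    IsUnit (toSeries θ (ofCenter θ D)) := by
  have h : (toSeries θ).comp (ofCenter θ) =
      (ofPowerSeries θ (fixedField θ) (orderOf θ) hθ.orderOf_pos (pow_orderOf_eq_one θ)).comp
        Polynomial.coeToPowerSeries.ringHom := by
    refine RingHom.ext fun p => ?_
    induction p using Polynomial.induction_on' with
    | add p q hp hq => rw [map_add, map_add, hp, hq]
    | monomial k a => simp [ofCenter_monomial, ofPowerSeries_monomial]
  have h' := DFunLike.congr_fun h D
  simp only [RingHom.comp_apply] at h'
  rw [h']
  exact isUnit_ofPowerSeries θ _ _ _ _ _ (by simpa using hD)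

/-- The Taylor expansion at `0`, `TS₀ : Frac(𝒜) → K((X; θ))`: the extension of the inclusion
`𝒜 → K((X; θ))`. -/
def taylorZero (hθ : IsOfFinOrder θ) : SkewFrac θ →+* SkewLaurentSeries θ :=
  fracLift (toSeries θ) (isUnit_toSeries_ofCenter θ hθ)

/-- The isomorphism `K[X^{±1}; θ] → K[X̃^{±1}; θ⁻¹]`, `X ↦ X̃⁻¹`. -/
def invertX : SkewLaurent θ →+* SkewLaurent θ⁻¹ :=
  SkewLaurent.lift θ (SkewLaurent.C θ⁻¹)
    ⟨monomial θ⁻¹ (-1) 1, monomial θ⁻¹ 1 1,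
      by rw [monomial_mul_monomial]; simp [SkewLaurent.one_def],
      by rw [monomial_mul_monomial]; simp [SkewLaurent.one_def]⟩
    (fun a => by
      change monomial θ⁻¹ (-1) 1 * monomial θ⁻¹ 0 a = monomial θ⁻¹ 0 (θ a) * monomial θ⁻¹ (-1) 1
      rw [monomial_mul_monomial, monomial_mul_monomial]
      simp)

theorem invertX_monomial (n : ℤ) (a : K) :
    invertX θ (monomial θ n a) = monomial θ⁻¹ (-n) a := by
  have key : ∀ (x : (SkewLaurent θ⁻¹)ˣ), (x : SkewLaurent θ⁻¹) = monomial θ⁻¹ (-1) 1 →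
      ((x⁻¹ : (SkewLaurent θ⁻¹)ˣ) : SkewLaurent θ⁻¹) = monomial θ⁻¹ 1 1 →
      ∀ n : ℤ, ((x ^ n : (SkewLaurent θ⁻¹)ˣ) : SkewLaurent θ⁻¹) = monomial θ⁻¹ (-n) 1 := by
    intro x hx hx' n
    induction n with
    | zero => rfl
    | succ n ih =>
      rw [zpow_add_one, Units.val_mul, ih, hx, monomial_mul_monomial, map_one, mul_one, neg_add]
    | pred n ih =>
      rw [zpow_sub_one, Units.val_mul, ih, hx', monomial_mul_monomial, map_one, mul_one]
      congr 1
      ring_nf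
  rw [invertX, lift_monomial, key _ rfl rfl]
  change monomial θ⁻¹ 0 a * _ = _
  rw [monomial_mul_monomial]
  simp

theorem isUnit_toSeries_invertX (hθ : IsOfFinOrder θ) (D : (fixedField θ)[X]) (hD : D ≠ 0) :
    IsUnit (toSeries θ⁻¹ (invertX θ (ofCenter θ D))) := by
  have hr : (θ⁻¹ : RingAut K) ^ orderOf θ = 1 := by rw [inv_pow, pow_orderOf_eq_one, inv_one]
  have key : ∀ N : ℕ, ∀ p : (fixedField θ)[X], p.natDegree ≤ N →
      toSeries θ⁻¹ (monomial θ⁻¹ ((orderOf θ : ℤ) * N) 1) *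
        toSeries θ⁻¹ (invertX θ (ofCenter θ p)) =
      ofPowerSeries θ⁻¹ (fixedField θ) (orderOf θ) hθ.orderOf_pos hr
        (p.reflect N : (fixedField θ)[X]) := by
    intro N p hp
    refine Polynomial.induction_with_natDegree_le (fun p => toSeries θ⁻¹ (monomial θ⁻¹
      ((orderOf θ : ℤ) * N) 1) * toSeries θ⁻¹ (invertX θ (ofCenter θ p)) =
      ofPowerSeries θ⁻¹ (fixedField θ) (orderOf θ) hθ.orderOf_pos hr
        (p.reflect N : (fixedField θ)[X])) N ?_ ?_ ?_ p hp
    · simp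
    · intro n a _ hn
      rw [Polynomial.reflect_C_mul_X_pow, Polynomial.C_mul_X_pow_eq_monomial,
        Polynomial.C_mul_X_pow_eq_monomial, Polynomial.revAt_le hn, ofCenter_monomial,
        invertX_monomial, Polynomial.coe_monomial, ofPowerSeries_monomial, ← map_mul,
        monomial_mul_monomial, zpow_mul, zpow_natCast, zpow_natCast, hr, one_pow, RingAut.one_apply, one_mul,
        Nat.cast_sub hn]
      congr 2
      ring_nf
    · intro f g _ _ hf hg
      rw [map_add, map_add, map_add, mul_add, hf, hg, Polynomial.reflect_add, Polynomial.coe_add,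
        map_add]
  have h := key _ D le_rfl
  have hu : IsUnit (toSeries θ⁻¹ (monomial θ⁻¹ ((orderOf θ : ℤ) * D.natDegree) 1)) :=
    isUnit_toSeries_monomial _ _
  rw [← hu.mul_left_iff, h]
  exact isUnit_ofPowerSeries θ⁻¹ _ _ _ _ _ (by simpa using hD)

/-- The Taylor expansion at infinity, `TS_∞ : Frac(𝒜) → K((X̃; θ⁻¹))`, where `X̃ = X⁻¹`. -/
def taylorInfty (hθ : IsOfFinOrder θ) : SkewFrac θ →+* SkewLaurentSeries θ⁻¹ :=
  fracLift ((toSeries θ⁻¹).comp (invertX θ)) (isUnit_toSeries_invertX θ hθ)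

/-! ### Quotients, completions and section operators -/

/-- The ideal `N𝒜` for `N ∈ F[Y]`. -/
abbrev skewIdeal (N : (fixedField θ)[X]) : Ideal (SkewLaurent θ) := Ideal.span {ofCenter θ N}

instance isTwoSided_skewIdeal (N : (fixedField θ)[X]) : (skewIdeal θ N).IsTwoSided where
  mul_mem_of_left {a} b ha := by
    obtain ⟨c, rfl⟩ := Ideal.mem_span_singleton'.1 ha
    refine Ideal.mem_span_singleton'.2 ⟨c * b, ?_⟩
    rw [mul_assoc, mul_assoc, (ofCenter_commute θ N b).eq]

/-- The quotient `𝒜/N𝒜`. -/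
abbrev SkewQuot (N : (fixedField θ)[X]) : Type _ := SkewLaurent θ ⧸ skewIdeal θ N

theorem skewIdeal_pow_le (N : (fixedField θ)[X]) {m n : ℕ} (h : m ≤ n) :
    skewIdeal θ (N ^ n) ≤ skewIdeal θ (N ^ m) := by
  refine (Ideal.span_singleton_le_iff_mem _).2 (Ideal.mem_span_singleton'.2
    ⟨ofCenter θ (N ^ (n - m)), ?_⟩)
  rw [← map_mul, ← pow_add, Nat.sub_add_cancel h]

/-- The completion `𝒜̂_N`, the inverse limit of the rings `𝒜/N^m𝒜`. -/
def SkewCompletion (N : (fixedField θ)[X]) : Subring (∀ m : ℕ, SkewQuot θ (N ^ m)) where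
  carrier := {x | ∀ (m n : ℕ) (h : m ≤ n),
    Ideal.Quotient.factor (skewIdeal_pow_le θ N h) (x n) = x m}
  zero_mem' _ _ _ := map_zero _
  one_mem' _ _ _ := map_one _
  add_mem' hx hy m n h := (map_add _ _ _).trans (congrArg₂ _ (hx m n h) (hy m n h))
  mul_mem' hx hy m n h := (map_mul _ _ _).trans (congrArg₂ _ (hx m n h) (hy m n h))
  neg_mem' hx m n h := (map_neg _ _).trans (congrArg _ (hx m n h))

/-- The natural map `𝒜 → 𝒜̂_N`. -/
def toCompletion (N : (fixedField θ)[X]) : SkewLaurent θ →+* SkewCompletion θ N :=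
  (RingHom.pi fun m => Ideal.Quotient.mk (skewIdeal θ (N ^ m))).codRestrict (SkewCompletion θ N)
    (fun _ _ _ _ => rfl)

/-- The section operator `sec_j : 𝒜 → 𝒞 = K[Y^{±1}]`, `∑ aₙ Xⁿ ↦ ∑ᵢ a_{j + i r} Yⁱ`. -/
def sec (j : ℤ) : SkewLaurent θ →+ K[T;T⁻¹] where
  toFun f := SkewMonoidAlgebra.sum f fun n a =>
    if (orderOf θ : ℤ) ∣ n.toAdd - j then
      LaurentPolynomial.C a * LaurentPolynomial.T ((n.toAdd - j) / orderOf θ) else 0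
  map_zero' := SkewMonoidAlgebra.sum_zero_index
  map_add' f g := SkewMonoidAlgebra.sum_add_index' (by simp) (by
    intros; split_ifs <;> simp [add_mul])

theorem sec_monomial (j n : ℤ) (a : K) :
    sec θ j (monomial θ n a) = if (orderOf θ : ℤ) ∣ n - j then
      LaurentPolynomial.C a * LaurentPolynomial.T ((n - j) / orderOf θ) else 0 := by
  refine (SkewMonoidAlgebra.sum_single_index (a := Multiplicative.ofAdd n) (b := a)
    (h := fun n a => if (orderOf θ : ℤ) ∣ n.toAdd - j then
      LaurentPolynomial.C a * LaurentPolynomial.T ((n.toAdd - j) / orderOf θ) else 0) ?_).trans rfl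
  simp

/-- `F[Y] → 𝒞 = K[Y^{±1}]`. -/
def toLaurent : (fixedField θ)[X] →+* K[T;T⁻¹] :=
  Polynomial.toLaurent.comp (Polynomial.mapRingHom (fixedField θ).subtype)

theorem sec_mul_ofCenter (hθ : IsOfFinOrder θ) (j : ℤ) (f : SkewLaurent θ)
    (N : (fixedField θ)[X]) :
    sec θ j (f * ofCenter θ N) = sec θ j f * toLaurent θ N := by
  have hr : (orderOf θ : ℤ) ≠ 0 := by exact_mod_cast hθ.orderOf_pos.ne'
  induction N using Polynomial.induction_on' with
  | add p q hp hq => rw [map_add, mul_add, map_add, hp, hq, map_add, mul_add]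
  | monomial k b =>
    induction f using SkewLaurent.induction_on with
    | h0 => simp
    | ha f g hf hg => rw [add_mul, map_add, hf, hg, map_add, add_mul]
    | hm n a =>
      have h1 : toLaurent θ (Polynomial.monomial k b) =
          LaurentPolynomial.C (b : K) * LaurentPolynomial.T k := by
        simp [toLaurent, ← Polynomial.C_mul_X_pow_eq_monomial]
      have h2 : n + orderOf θ * k - j = n - j + orderOf θ * k := by ring
      rw [← (ofCenter_commute θ _ _).eq, ofCenter_monomial, monomial_mul_monomial, zpow_mul,
        zpow_natCast, zpow_natCast, pow_orderOf_eq_one, one_pow, RingAut.one_apply, sec_monomial,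
        sec_monomial, h1, add_comm, h2]
      simp only [Int.dvd_add_left (dvd_mul_right (orderOf θ : ℤ) (k : ℤ))]
      split_ifs with h
      · rw [Int.add_mul_ediv_left _ _ hr, LaurentPolynomial.T_add, map_mul]
        ring
      · simp

/-- The map `𝒜/N𝒜 → 𝒞/N𝒞` induced by `sec_j`. -/
def secQuot (hθ : IsOfFinOrder θ) (j : ℤ) (N : (fixedField θ)[X]) :
    SkewQuot θ N →+ K[T;T⁻¹] ⧸ Ideal.span {toLaurent θ N} :=
  QuotientAddGroup.lift (skewIdeal θ N).toAddSubgroup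
    ((Ideal.Quotient.mk (Ideal.span {toLaurent θ N})).toAddMonoidHom.comp (sec θ j)) (by
      intro f hf
      obtain ⟨g, rfl⟩ := Ideal.mem_span_singleton'.1 hf
      refine Ideal.Quotient.eq_zero_iff_mem.2 ?_
      rw [sec_mul_ofCenter θ hθ]
      exact Ideal.mul_mem_left _ _ (Ideal.mem_span_singleton_self _))

/-! ### Taylor expansions and residues at the points of the separable closure -/

variable {Fs : Type*} [Field Fs] [Algebra (fixedField θ) Fs]

/-- A `z`-admissible morphism, `N` being the minimal polynomial of `z` over `F`: a homomorphism of
`K`-algebras `τ : 𝒜̂_N → (𝒜/N𝒜)[[T]]` with `τ(X) ≡ X mod T` and `τ(Y) = z + T`, where `Y = X^r` and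
`z` stands for the class of `Y` in `𝒜/N𝒜`. -/
structure AdmissibleMorphism (z : Fs) where
  toRingHom : SkewCompletion θ (minpoly (fixedField θ) z) →+*
    PowerSeries (SkewQuot θ (minpoly (fixedField θ) z))
  map_C : ∀ a : K, toRingHom (toCompletion θ _ (SkewLaurent.C θ a)) =
    PowerSeries.C (Ideal.Quotient.mk _ (SkewLaurent.C θ a))
  map_X : PowerSeries.constantCoeff (toRingHom (toCompletion θ _ (SkewLaurent.X θ))) =
    Ideal.Quotient.mk _ (SkewLaurent.X θ)
  map_Y : toRingHom (toCompletion θ _ (SkewLaurent.X θ ^ orderOf θ)) =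
    PowerSeries.C (Ideal.Quotient.mk _ (SkewLaurent.X θ ^ orderOf θ)) + PowerSeries.X

variable {θ} in
/-- The restriction to `𝒜` of an admissible morphism, with values in `(𝒜/N𝒜)((T))`. -/
def AdmissibleMorphism.toLaurentSeries {z : Fs} (τ : AdmissibleMorphism θ z) :
    SkewLaurent θ →+* LaurentSeries (SkewQuot θ (minpoly (fixedField θ) z)) :=
  (HahnSeries.ofPowerSeries ℤ _).comp (τ.toRingHom.comp (toCompletion θ _))

variable {θ} in
theorem AdmissibleMorphism.isUnit [IsSepClosure (fixedField θ) Fs] {z : Fs}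
    (τ : AdmissibleMorphism θ z) (D : (fixedField θ)[X]) (hD : D ≠ 0) :
    IsUnit (τ.toLaurentSeries (ofCenter θ D)) := by
  have : Algebra.IsSeparable (fixedField θ) Fs := IsSepClosure.separable
  set N := minpoly (fixedField θ) z with hN
  have : Fact (Irreducible N) := ⟨minpoly.irreducible (Algebra.IsIntegral.isIntegral z)⟩
  let e : AdjoinRoot N →+* SkewQuot θ N :=
    Ideal.Quotient.lift (Ideal.span {N}) ((Ideal.Quotient.mk _).comp (ofCenter θ)) (by
      intro a ha
      obtain ⟨b, rfl⟩ := Ideal.mem_span_singleton'.1 ha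
      refine Ideal.Quotient.eq_zero_iff_mem.2 ?_
      rw [map_mul]
      exact Ideal.mul_mem_left _ _ (Ideal.mem_span_singleton_self _))
  let ψ : PowerSeries (AdjoinRoot N) →+* LaurentSeries (SkewQuot θ N) :=
    (HahnSeries.ofPowerSeries ℤ _).comp (PowerSeries.map e)
  let ev : (fixedField θ)[X] →+* PowerSeries (AdjoinRoot N) :=
    Polynomial.coeToPowerSeries.ringHom.comp
      ((Polynomial.compRingHom (Polynomial.X + Polynomial.C (AdjoinRoot.root N))).comp
        (Polynomial.mapRingHom (AdjoinRoot.of N)))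
  have h : τ.toLaurentSeries.comp (ofCenter θ) = ψ.comp ev := by
    refine Polynomial.ringHom_ext (fun a => ?_) ?_
    · have h1 : ofCenter θ (Polynomial.C a) = SkewLaurent.C θ (a : K) :=
        Polynomial.eval₂_C _ _
      simp only [RingHom.comp_apply, AdmissibleMorphism.toLaurentSeries, h1, τ.map_C, ψ, ev]
      have h3 : e (AdjoinRoot.of N a) = Ideal.Quotient.mk _ (SkewLaurent.C θ (a : K)) := by
        rw [← h1]; rfl
      congr 1
      simp [h3]
      rfl
    · have h1 : ofCenter θ Polynomial.X = SkewLaurent.X θ ^ orderOf θ :=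
        Polynomial.eval₂_X _ _
      simp only [RingHom.comp_apply, AdmissibleMorphism.toLaurentSeries, h1, τ.map_Y, ψ, ev]
      have h3 : e (AdjoinRoot.root N) = Ideal.Quotient.mk _ (SkewLaurent.X θ ^ orderOf θ) := by
        rw [← h1]; rfl
      congr 1
      simp [h3, add_comm]
      rfl
  have h' := DFunLike.congr_fun h D
  simp only [RingHom.comp_apply] at h'
  rw [h']
  refine isUnit_map_powerSeries ψ ?_ _ ?_
  · simp only [ψ, RingHom.comp_apply, PowerSeries.map_X, HahnSeries.ofPowerSeries_X]
    refine ⟨⟨HahnSeries.single 1 1, HahnSeries.single (-1) 1, ?_, ?_⟩, rfl⟩ <;>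
    · rw [HahnSeries.single_mul_single]
      simp
  · have h2 : Polynomial.taylor (AdjoinRoot.root N) (D.map (AdjoinRoot.of N)) ≠ 0 := by
      rw [Ne, Polynomial.taylor_eq_zero, Polynomial.map_eq_zero]
      exact hD
    intro h0
    apply h2
    rw [Polynomial.taylor_apply]
    simpa [ev] using h0

variable {θ} in
/-- The Taylor expansion `TS_z : Frac(𝒜) → (𝒜/N𝒜)((T))` attached to an admissible morphism. -/
def AdmissibleMorphism.taylor [IsSepClosure (fixedField θ) Fs] {z : Fs}
    (τ : AdmissibleMorphism θ z) :
    SkewFrac θ →+* LaurentSeries (SkewQuot θ (minpoly (fixedField θ) z)) :=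
  fracLift τ.toLaurentSeries τ.isUnit

variable {θ} in
/-- The skew residue `sres_z(f) ∈ 𝒜/N𝒜` at a nonzero point `z`: the coefficient of `T⁻¹`. -/
def AdmissibleMorphism.skewResidue [IsSepClosure (fixedField θ) Fs] {z : Fs}
    (τ : AdmissibleMorphism θ z) (f : SkewFrac θ) : SkewQuot θ (minpoly (fixedField θ) z) :=
  (τ.taylor f).coeff (-1)

/-- The embedding `ι_z : 𝒞/N𝒞 → K ⊗_F F^s`, `a ↦ a ⊗ 1` for `a ∈ K`, `Y ↦ 1 ⊗ z`. -/
def iota (z : Fs) (hz : z ≠ 0) :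
    K[T;T⁻¹] ⧸ Ideal.span {toLaurent θ (minpoly (fixedField θ) z)} →+* K ⊗[fixedField θ] Fs :=
  Ideal.Quotient.lift _
    (LaurentPolynomial.eval₂ (Algebra.TensorProduct.includeLeftRingHom)
      (Units.map ((Algebra.TensorProduct.includeRight :
        Fs →ₐ[fixedField θ] K ⊗[fixedField θ] Fs) : Fs →* K ⊗[fixedField θ] Fs)
        (Units.mk0 z hz))) (by
      intro a ha
      obtain ⟨b, rfl⟩ := Ideal.mem_span_singleton'.1 ha
      rw [map_mul, toLaurent, RingHom.comp_apply, LaurentPolynomial.eval₂_toLaurent,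
        Polynomial.coe_mapRingHom, Polynomial.eval₂_map]
      have h : (Algebra.TensorProduct.includeLeftRingHom :
          K →+* K ⊗[fixedField θ] Fs).comp (fixedField θ).subtype =
          algebraMap (fixedField θ) (K ⊗[fixedField θ] Fs) := rfl
      rw [h, ← Polynomial.aeval_def]
      change _ * Polynomial.aeval ((Algebra.TensorProduct.includeRight :
        Fs →ₐ[fixedField θ] K ⊗[fixedField θ] Fs) z) _ = 0
      rw [Polynomial.aeval_algHom_apply, minpoly.aeval, map_zero, mul_zero])

/-- The `j`-th partial skew residue `sres_{z,j}(f) ∈ K ⊗_F F^s` at `z ∈ F^s ⊔ {∞}`, with respect to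
a choice `τ` of an admissible morphism at each nonzero point of `F^s`. Elements `c` of `K` are viewed
as elements `c ⊗ 1` of `K ⊗_F F^s`. -/
def partialSkewResidue [IsSepClosure (fixedField θ) Fs] (hθ : IsOfFinOrder θ)
    (τ : ∀ z : Fs, z ≠ 0 → AdmissibleMorphism θ z) (j : ℤ) (f : SkewFrac θ) :
    OnePoint Fs → K ⊗[fixedField θ] Fs
  | ∞ => (-SkewLaurentSeries.coeff θ⁻¹ (orderOf θ - j) (taylorInfty θ hθ f)) ⊗ₜ 1
  | (z : Fs) =>
    open Classical in
    if hz : z = 0 then SkewLaurentSeries.coeff θ (j - orderOf θ) (taylorZero θ hθ f) ⊗ₜ 1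
    else iota θ z hz (secQuot θ hθ j _ ((τ z hz).skewResidue f))

/-- All the finite poles of `f` lie in `F^s`: `f = D⁻¹ g` with `g ∈ 𝒜` and `0 ≠ D ∈ F[Y]` a product
of linear factors over `F^s`. -/
def PolesIn (Fs : Type*) [Field Fs] [Algebra (fixedField θ) Fs] (f : SkewFrac θ) : Prop :=
  ∃ D : (fixedField θ)[X], D ≠ 0 ∧ (D.map (algebraMap (fixedField θ) Fs)).Splits ∧
    ∃ g : SkewLaurent θ, toFrac θ (ofCenter θ D) * f = toFrac θ g

/-- The condition on the poles is automatic when `F` is perfect. -/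
theorem polesIn_of_perfectField [PerfectField (fixedField θ)] [IsSepClosure (fixedField θ) Fs]
    (f : SkewFrac θ) : PolesIn θ Fs f := by
  have : IsAlgClosure (fixedField θ) Fs := inferInstance
  have : IsAlgClosed Fs := IsAlgClosure.isAlgClosed (fixedField θ)
  induction f using OreLocalization.ind with
  | _ g s =>
    obtain ⟨_, D, hD, rfl⟩ := s
    refine ⟨D, nonZeroDivisors.ne_zero hD, IsAlgClosed.splits _, g, ?_⟩
    exact OreLocalization.mul_cancel (s := (⟨_, D, hD, rfl⟩ : denominators θ))

end SkewResidue
end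

/-! The summation formula comes from the residue theorem on the projective line over `F^s`, where
by partial fractions it suffices to treat `(Y - z)⁻ⁿ`, whose residues at `z` and `∞` cancel. After
multiplication by a central denominator `D ∈ F[Y]`, an element of `Frac(𝒜)` is a sum of monomials
`a Xⁿ`, so `f = D⁻¹ a Xⁿ` may be assumed. If `n = rk`, then `f = a · (Yᵏ / D)`, and its `0`-th
partial skew residues are `a ⊗ 1` times the classical residues of `Yᵏ / D`. If `r ∤ n`, there is
`b ∈ K` with `θⁿ(b) ≠ b`, and `f b = θⁿ(b) f`; since `sres_{z,0}` is `K`-linear on both sides, it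
vanishes on `f`.

Admissible morphisms come from a deformation `φ : 𝒜 → 𝒜[[T]]` with `φ(Y) = Y + T`. Put
`φ(X) = (1 + a G(Y⁻¹ T)) X` with `a ∈ K` and `G ∈ F[[S]]`; then `φ(Y) = P(G(Y⁻¹ T)) Y` with
`P(S) = ∏_{i < r} (1 + θⁱ(a) S)`. When `a` has nonzero trace, the linear term of `P - 1 ∈ F[S]` is
nonzero, so `G` can be chosen with `P(G) = 1 + S`. As `φ` reduced modulo `N` sends `N` to a multiple
of `T`, it extends to the completion at `N`. -/

noncomputable section

namespace SkewResidue

section ZeroSum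

variable {ι M N : Type*} [AddCommMonoid M] [AddCommMonoid N]

/-- A family with finitely many nonzero terms, which add up to zero. -/
def HasZeroSum (ρ : ι → M) : Prop :=
  (Function.support ρ).Finite ∧ ∑ᶠ i, ρ i = 0

theorem HasZeroSum.zero : HasZeroSum (0 : ι → M) :=
  ⟨by simp, finsum_zero⟩

theorem HasZeroSum.add {ρ σ : ι → M} (hρ : HasZeroSum ρ) (hσ : HasZeroSum σ) :
    HasZeroSum (ρ + σ) :=
  ⟨(hρ.1.union hσ.1).subset (Function.support_add _ _),
    (finsum_add_distrib hρ.1 hσ.1).trans (by rw [hρ.2, hσ.2, add_zero])⟩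

theorem HasZeroSum.map {ρ : ι → M} (hρ : HasZeroSum ρ) (φ : M →+ N) :
    HasZeroSum fun i => φ (ρ i) :=
  ⟨hρ.1.subset (Function.support_comp_subset (map_zero φ) ρ),
    by rw [← φ.map_finsum hρ.1, hρ.2, map_zero]⟩

theorem hasZeroSum_of_pair {ρ : ι → M} {i j : ι} (hij : i ≠ j) (h : ρ i + ρ j = 0)
    (hρ : ∀ k, k ≠ i → k ≠ j → ρ k = 0) : HasZeroSum ρ := by
  classical
  have hsupp : Function.support ρ ⊆ ({i, j} : Finset ι) := fun k hk => by
    by_contra hk'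
    simp only [Finset.coe_insert, Finset.coe_singleton, Set.mem_insert_iff,
      Set.mem_singleton_iff, not_or] at hk'
    exact hk (hρ k hk'.1 hk'.2)
  refine ⟨(Finset.finite_toSet _).subset hsupp, ?_⟩
  rw [finsum_eq_sum_of_support_subset ρ hsupp, Finset.sum_pair hij, h]

end ZeroSum

section RatFunc

open scoped RatFunc

variable {F E L : Type*} [Field F] [Field E] [Field L]

theorem ratFunc_ringHom_ext {B : Type*} [Ring B] {φ ψ : RatFunc F →+* B}
    (hC : ∀ a, φ (RatFunc.C a) = ψ (RatFunc.C a)) (hX : φ RatFunc.X = ψ RatFunc.X) : φ = ψ :=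
  IsLocalization.ringHom_ext (nonZeroDivisors F[X]) (Polynomial.ringHom_ext hC hX)

/-- The homomorphism `F(X) → L(X)` induced by a homomorphism of fields `F → L`. -/
def mapRatFunc (σ : F →+* L) : RatFunc F →+* RatFunc L :=
  RatFunc.mapRingHom (Polynomial.mapRingHom σ)
    (nonZeroDivisors_le_comap_nonZeroDivisors_of_injective _
      (Polynomial.map_injective σ σ.injective))

@[simp]
theorem mapRatFunc_algebraMap (σ : F →+* L) (p : F[X]) :
    mapRatFunc σ (algebraMap F[X] (RatFunc F) p) = algebraMap L[X] (RatFunc L) (p.map σ) := by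
  rw [mapRatFunc, RatFunc.coe_mapRingHom_eq_coe_map]
  simpa using RatFunc.map_apply_div_ne_zero (Polynomial.mapRingHom σ) _ p 1 one_ne_zero

@[simp]
theorem mapRatFunc_C (σ : F →+* L) (a : F) :
    mapRatFunc σ (RatFunc.C a) = RatFunc.C (σ a) := by
  rw [← RatFunc.algebraMap_C, mapRatFunc_algebraMap, Polynomial.map_C, RatFunc.algebraMap_C]

@[simp]
theorem mapRatFunc_X (σ : F →+* L) : mapRatFunc σ RatFunc.X = RatFunc.X := by
  rw [← RatFunc.algebraMap_X, mapRatFunc_algebraMap, Polynomial.map_X, RatFunc.algebraMap_X]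

theorem mapRatFunc_mapRatFunc (τ : E →+* L) (σ : F →+* E) (h : RatFunc F) :
    mapRatFunc τ (mapRatFunc σ h) = mapRatFunc (τ.comp σ) h :=
  DFunLike.congr_fun (ratFunc_ringHom_ext (φ := (mapRatFunc τ).comp (mapRatFunc σ))
    (ψ := mapRatFunc (τ.comp σ)) (by simp) (by simp)) h

theorem coe_ratFunc_C (c : L) : ((RatFunc.C c : RatFunc L) : LaurentSeries L) = HahnSeries.C c := by
  rw [← RatFunc.algebraMap_C]
  exact (RatFunc.coe_coe _).symm.trans (by rw [Polynomial.coe_C, PowerSeries.coe_C])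

/-- The expansion `X ↦ z + T` of rational functions at `z`. -/
def expandAt (z : L) : RatFunc L →+* LaurentSeries L :=
  (algebraMap (RatFunc L) (LaurentSeries L)).comp (RatFunc.laurent z).toRingHom

@[simp]
theorem expandAt_C (z c : L) : expandAt z (RatFunc.C c) = HahnSeries.C c := by
  simp [expandAt, coe_ratFunc_C]

@[simp]
theorem expandAt_X (z : L) :
    expandAt z RatFunc.X = HahnSeries.C z + HahnSeries.single 1 1 := by
  simp [expandAt, coe_ratFunc_C, add_comm]

theorem expandAt_algebraMap (z : L) (p : L[X]) :
    expandAt z (algebraMap L[X] (RatFunc L) p) =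
      HahnSeries.ofPowerSeries ℤ L (Polynomial.taylor z p : L[X]) := by
  simp [expandAt, RatFunc.coe_coe]

theorem transcendental_inv_X : Transcendental L (RatFunc.X⁻¹ : RatFunc L) :=
  fun h => RatFunc.transcendental_X (IsAlgebraic.inv_iff.1 h)

/-- The expansion `X ↦ T⁻¹` of rational functions at infinity. -/
def expandInfty (L : Type*) [Field L] : RatFunc L →+* LaurentSeries L :=
  ((algebraMap (RatFunc L) (LaurentSeries L)).comp (algebraMap _ (RatFunc L))).comp
    (RatFunc.algEquivOfTranscendental _ (transcendental_inv_X (L := L))).toRingHom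

@[simp]
theorem expandInfty_C (c : L) : expandInfty L (RatFunc.C c) = HahnSeries.C c := by
  rw [← coe_ratFunc_C]
  simp [expandInfty, ← RatFunc.algebraMap_eq_C]

@[simp]
theorem expandInfty_X : expandInfty L RatFunc.X = HahnSeries.single (-1) 1 := by
  simp [expandInfty]

/-- The residue at `z` of the differential form `h(X) dX`. -/
def residue (h : RatFunc L) : OnePoint L → L
  | ∞ => -(expandInfty L h).coeff 1
  | (z : L) => (expandAt z h).coeff (-1)

theorem residue_infty (h : RatFunc L) : residue h ∞ = -(expandInfty L h).coeff 1 := rfl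

theorem residue_coe (h : RatFunc L) (z : L) : residue h z = (expandAt z h).coeff (-1) := rfl

theorem residue_zero : residue (0 : RatFunc L) = 0 := by
  funext z
  cases z <;> simp [residue_infty, residue_coe]

theorem residue_add (g h : RatFunc L) : residue (g + h) = residue g + residue h := by
  funext z
  cases z <;> simp [residue_infty, residue_coe, add_comm]

theorem residue_smul (c : L) (h : RatFunc L) : residue (c • h) = c • residue h := by
  funext z
  cases z <;> simp [residue_infty, residue_coe, RatFunc.smul_eq_C_mul]

theorem coeff_neg_one_ofPowerSeries {R : Type*} [Semiring R] (p : PowerSeries R) :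
    (HahnSeries.ofPowerSeries ℤ R p).coeff (-1) = 0 :=
  (PowerSeries.coeff_coe p _).trans (if_pos (by decide))

theorem residue_algebraMap (p : L[X]) : residue (algebraMap L[X] (RatFunc L) p) = 0 := by
  funext z
  cases z with
  | coe z => rw [residue_coe, expandAt_algebraMap, coeff_neg_one_ofPowerSeries, Pi.zero_apply]
  | infty =>
    rw [residue_infty, Pi.zero_apply, neg_eq_zero]
    induction p using Polynomial.induction_on' with
    | add p q hp hq => rw [map_add, map_add, HahnSeries.coeff_add, hp, hq, add_zero]
    | monomial n a =>
      have hn : (1 : ℤ) ≠ -n := by lia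
      simp [← Polynomial.C_mul_X_pow_eq_monomial, HahnSeries.single_pow, RatFunc.algebraMap_C,
        RatFunc.algebraMap_X, HahnSeries.coeff_single_of_ne hn]

/-- The rational function `(X - z)⁻¹`. -/
def simplePole (z : L) : RatFunc L := (RatFunc.X - RatFunc.C z)⁻¹

theorem expandAt_simplePole_self (z : L) :
    expandAt z (simplePole z) = HahnSeries.single (-1) 1 := by
  simp [simplePole, HahnSeries.inv_single]

theorem expandAt_simplePole_of_ne {z w : L} (hw : w ≠ z) :
    expandAt w (simplePole z) =
      HahnSeries.ofPowerSeries ℤ L (PowerSeries.X + PowerSeries.C (w - z))⁻¹ := by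
  have hunit : PowerSeries.constantCoeff (PowerSeries.X + PowerSeries.C (w - z)) ≠ 0 := by
    simpa using sub_ne_zero.2 hw
  rw [simplePole, map_inv₀]
  refine inv_eq_of_mul_eq_one_right ?_
  have hX : expandAt w (RatFunc.X - RatFunc.C z) =
      HahnSeries.ofPowerSeries ℤ L (PowerSeries.X + PowerSeries.C (w - z)) := by
    simp only [map_sub, map_add, expandAt_X, expandAt_C, HahnSeries.ofPowerSeries_X,
      HahnSeries.ofPowerSeries_C]
    ring
  rw [hX, ← map_mul, PowerSeries.mul_inv_cancel _ hunit, map_one]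

theorem expandInfty_simplePole (z : L) :
    expandInfty L (simplePole z) = HahnSeries.ofPowerSeries ℤ L
      (PowerSeries.X * (1 - PowerSeries.C z * PowerSeries.X)⁻¹) := by
  rw [simplePole, map_inv₀]
  refine inv_eq_of_mul_eq_one_right ?_
  have hX : expandInfty L (RatFunc.X - RatFunc.C z) = HahnSeries.single (-1) 1 *
      HahnSeries.ofPowerSeries ℤ L (1 - PowerSeries.C z * PowerSeries.X) := by
    simp [mul_sub, HahnSeries.C_apply, HahnSeries.single_mul_single]
  rw [hX, mul_assoc, ← map_mul, mul_left_comm, PowerSeries.mul_inv_cancel _ (by simp), mul_one,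
    HahnSeries.ofPowerSeries_X, HahnSeries.single_mul_single]
  simp

theorem residue_simplePole_pow_self (z : L) (n : ℕ) :
    residue (simplePole z ^ (n + 1)) z = if n = 0 then 1 else 0 := by
  rw [residue_coe, map_pow, expandAt_simplePole_self, HahnSeries.single_pow,
    HahnSeries.coeff_single]
  simp

theorem residue_simplePole_pow_of_ne {z w : L} (hw : w ≠ z) (n : ℕ) :
    residue (simplePole z ^ n) w = 0 := by
  rw [residue_coe, map_pow, expandAt_simplePole_of_ne hw, ← map_pow, coeff_neg_one_ofPowerSeries]

theorem residue_simplePole_pow_infty (z : L) (n : ℕ) :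
    residue (simplePole z ^ (n + 1)) ∞ = -if n = 0 then 1 else 0 := by
  have hcoeff (p : PowerSeries L) :
      (HahnSeries.ofPowerSeries ℤ L p).coeff 1 = PowerSeries.coeff 1 p :=
    LaurentSeries.coeff_coe_powerSeries p 1
  rw [residue_infty, map_pow, expandInfty_simplePole, ← map_pow, hcoeff, mul_pow,
    PowerSeries.coeff_X_pow_mul']
  rcases n with _ | n <;> simp

theorem hasZeroSum_residue_simplePole_pow (z : L) (n : ℕ) :
    HasZeroSum (residue (simplePole z ^ (n + 1))) := by
  refine hasZeroSum_of_pair (OnePoint.coe_ne_infty z) ?_ fun w hwz hw => ?_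
  · rw [residue_simplePole_pow_self, residue_simplePole_pow_infty, add_neg_cancel]
  · cases w with
    | infty => exact absurd rfl hw
    | coe w => exact residue_simplePole_pow_of_ne (fun h => hwz (congrArg _ h)) _

theorem ratFunc_div_mem_of_splits (V : Submodule L (RatFunc L))
    (hpoly : ∀ p, algebraMap L[X] (RatFunc L) p ∈ V) (hpole : ∀ z n, simplePole z ^ (n + 1) ∈ V)
    (p : L[X]) {q : L[X]} (hq : q.Splits) :
    algebraMap L[X] (RatFunc L) p / algebraMap L[X] (RatFunc L) q ∈ V := by
  classical
  have hinv (z : L) :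
      simplePole z * algebraMap L[X] (RatFunc L) (Polynomial.X - Polynomial.C z) = 1 := by
    rw [simplePole, ← RatFunc.algebraMap_X, ← RatFunc.algebraMap_C, ← map_sub]
    exact inv_mul_cancel₀ (RatFunc.algebraMap_ne_zero (Polynomial.X_sub_C_ne_zero z))
  have hdiv : algebraMap L[X] (RatFunc L) p / algebraMap L[X] (RatFunc L) q =
      q.leadingCoeff⁻¹ • (algebraMap L[X] (RatFunc L) p *
        ∏ z ∈ q.roots.toFinset, simplePole z ^ q.roots.count z) := by
    conv_lhs => rw [hq.eq_prod_roots]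
    rw [← Finset.prod_multiset_map_count, RatFunc.smul_eq_C_mul, map_mul, map_multiset_prod,
      RatFunc.algebraMap_C, map_inv₀, div_eq_mul_inv, mul_inv, mul_left_comm,
      ← Multiset.prod_map_inv, Multiset.map_map]
    simp only [Function.comp_def, simplePole, map_sub, RatFunc.algebraMap_X, RatFunc.algebraMap_C]
    rfl
  obtain ⟨s, r, hr, hfrac⟩ :=
    Polynomial.mul_prod_pow_inverse_eq_quo_add_sum_rem_mul_pow_inverse (K := RatFunc L)
      (s := q.roots.toFinset) p (fun z _ => Polynomial.monic_X_sub_C z)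
      (fun z _ w _ hzw => Polynomial.pairwise_coprime_X_sub_C Function.injective_id hzw)
      (fun z => q.roots.count z) fun z _ => hinv z
  rw [hdiv, hfrac]
  refine V.smul_mem _ (V.add_mem (hpoly s) (V.sum_mem fun z hz => V.sum_mem fun j _ => ?_))
  have hconst : (r z j).degree ≤ 0 := by
    simpa only [Polynomial.degree_X_sub_C, Nat.WithBot.lt_one_iff_le_zero] using hr z hz j
  rw [Polynomial.eq_C_of_degree_le_zero hconst, RatFunc.algebraMap_C, ← RatFunc.smul_eq_C_mul]
  exact V.smul_mem _ (hpole z j)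

theorem hasZeroSum_residue_div (p : L[X]) {q : L[X]} (hq : q.Splits) :
    HasZeroSum (residue (algebraMap L[X] (RatFunc L) p / algebraMap L[X] (RatFunc L) q)) := by
  let V : Submodule L (RatFunc L) :=
    { carrier := {h | HasZeroSum (residue h)}
      zero_mem' := by simp [residue_zero, HasZeroSum.zero]
      add_mem' hg hh := by simpa [residue_add] using HasZeroSum.add hg hh
      smul_mem' c h hh := by
        simpa [residue_smul, Pi.smul_def] using HasZeroSum.map hh (AddMonoidHom.mulLeft c) }
  refine ratFunc_div_mem_of_splits V (fun p => ?_) hasZeroSum_residue_simplePole_pow p hq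
  simpa [V, residue_algebraMap] using HasZeroSum.zero

theorem hasZeroSum_residue_zpow_div (k : ℤ) {q : L[X]} (hq : q.Splits) :
    HasZeroSum (residue ((RatFunc.X : RatFunc L) ^ k / algebraMap L[X] (RatFunc L) q)) := by
  obtain ⟨n, rfl | rfl⟩ := k.eq_nat_or_neg
  · rw [zpow_natCast, ← RatFunc.algebraMap_X, ← map_pow]
    exact hasZeroSum_residue_div _ hq
  · rw [zpow_neg, zpow_natCast, ← one_div, div_div, ← RatFunc.algebraMap_X, ← map_pow, ← map_mul,
      ← map_one (algebraMap L[X] (RatFunc L))]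
    exact hasZeroSum_residue_div _ ((Polynomial.Splits.X.pow n).mul hq)

end RatFunc

section CoefficientwiseMap

variable {R S : Type*} [Ring R] [Ring S]

/-- The homomorphism `R((T)) → S((T))` obtained by applying `σ : R → S` to the coefficients. -/
def mapSeries (σ : R →+* S) : LaurentSeries R →+* LaurentSeries S where
  toFun s := HahnSeries.map s σ
  map_zero' := HahnSeries.map_zero (σ : ZeroHom R S)
  map_one' := HahnSeries.map_one σ.toMonoidWithZeroHom
  map_add' _ _ := HahnSeries.map_add (σ : R →+ S)
  map_mul' _ _ := HahnSeries.map_mul (σ : R →ₙ+* S)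

theorem mapSeries_coeff (σ : R →+* S) (s : LaurentSeries R) (i : ℤ) :
    (mapSeries σ s).coeff i = σ (s.coeff i) := rfl

@[simp]
theorem mapSeries_single (σ : R →+* S) (i : ℤ) (a : R) :
    mapSeries σ (HahnSeries.single i a) = HahnSeries.single i (σ a) :=
  HahnSeries.map_single (σ : ZeroHom R S)

end CoefficientwiseMap

section ChangeOfField

variable {F E L : Type*} [Field F] [Field E] [Field L]

theorem mapSeries_expandAt (σ : E →+* L) (z : E) (h : RatFunc E) :
    mapSeries σ (expandAt z h) = expandAt (σ z) (mapRatFunc σ h) :=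
  DFunLike.congr_fun (ratFunc_ringHom_ext (φ := (mapSeries σ).comp (expandAt z))
    (ψ := (expandAt (σ z)).comp (mapRatFunc σ)) (by simp) (by simp)) h

theorem mapSeries_expandInfty (σ : E →+* L) (h : RatFunc E) :
    mapSeries σ (expandInfty E h) = expandInfty L (mapRatFunc σ h) :=
  DFunLike.congr_fun (ratFunc_ringHom_ext (φ := (mapSeries σ).comp (expandInfty E))
    (ψ := (expandInfty L).comp (mapRatFunc σ)) (by simp) (by simp)) h

theorem residue_mapRatFunc_coe (σ : E →+* L) (h : RatFunc E) (z : E) :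
    residue (mapRatFunc σ h) (σ z) = σ (residue h z) := by
  rw [residue_coe, residue_coe, ← mapSeries_expandAt, mapSeries_coeff]

theorem residue_mapRatFunc_infty (σ : E →+* L) (h : RatFunc E) :
    residue (mapRatFunc σ h) ∞ = σ (residue h ∞) := by
  rw [residue_infty, residue_infty, ← mapSeries_expandInfty, mapSeries_coeff, map_neg]

/-- The extension to `F(X)` of a homomorphism from `F[X]` to a possibly noncommutative ring which
sends nonzero polynomials to units. -/
def ratFuncLift {B : Type*} [Ring B] (φ : F[X] →+* B) (hφ : ∀ p, p ≠ 0 → IsUnit (φ p)) :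
    RatFunc F →+* B :=
  (OreLocalization.universalHom φ
    (IsUnit.liftRight ((φ : F[X] →* B).comp (nonZeroDivisors F[X]).subtype)
      fun p => hφ p (nonZeroDivisors.ne_zero p.2)) fun _ => rfl).comp
    (IsLocalization.algEquiv (nonZeroDivisors F[X]) (RatFunc F)
      (FractionRing F[X])).toRingEquiv.toRingHom

theorem ratFuncLift_algebraMap {B : Type*} [Ring B] (φ : F[X] →+* B)
    (hφ : ∀ p, p ≠ 0 → IsUnit (φ p)) (p : F[X]) :
    ratFuncLift φ hφ (algebraMap F[X] (RatFunc F) p) = φ p := by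
  have hp : IsLocalization.algEquiv (nonZeroDivisors F[X]) (RatFunc F) (FractionRing F[X])
      (algebraMap F[X] (RatFunc F) p) = OreLocalization.numeratorHom p :=
    AlgEquiv.commutes _ p
  exact (congrArg _ hp).trans (OreLocalization.universalHom_commutes φ _ fun _ => rfl)

end ChangeOfField

section CentralFractions

variable {K : Type*} [Field K] (θ : RingAut K)

theorem C_mul_monomial (a : K) (n : ℤ) (b : K) :
    SkewLaurent.C θ a * SkewLaurent.monomial θ n b = SkewLaurent.monomial θ n (a * b) :=
  (SkewLaurent.monomial_mul_monomial θ 0 n a b).trans (by simp)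

theorem monomial_mul_C (n : ℤ) (a b : K) :
    SkewLaurent.monomial θ n a * SkewLaurent.C θ b =
      SkewLaurent.monomial θ n (a * (θ ^ n) b) :=
  (SkewLaurent.monomial_mul_monomial θ n 0 a b).trans (by rw [add_zero])

@[simp]
theorem ofCenter_C (a : fixedField θ) :
    ofCenter θ (Polynomial.C a) = SkewLaurent.C θ (a : K) :=
  Polynomial.eval₂_C _ _

@[simp]
theorem ofCenter_X : ofCenter θ Polynomial.X = SkewLaurent.X θ ^ orderOf θ :=
  Polynomial.eval₂_X _ _

theorem isUnit_toFrac_ofCenter (D : (fixedField θ)[X]) (hD : D ≠ 0) :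
    IsUnit (toFrac θ (ofCenter θ D)) :=
  OreLocalization.numerator_isUnit
    (⟨_, D, mem_nonZeroDivisors_of_ne_zero hD, rfl⟩ : denominators θ)

/-- The homomorphism `F(Y) → Frac(𝒜)`, `Y ↦ X^r`, where `r` is the order of `θ`. -/
def centerFrac : RatFunc (fixedField θ) →+* SkewFrac θ :=
  ratFuncLift ((toFrac θ).comp (ofCenter θ)) (isUnit_toFrac_ofCenter θ)

theorem centerFrac_algebraMap (p : (fixedField θ)[X]) :
    centerFrac θ (algebraMap _ _ p) = toFrac θ (ofCenter θ p) :=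
  ratFuncLift_algebraMap _ _ p

@[simp]
theorem centerFrac_C (a : fixedField θ) :
    centerFrac θ (RatFunc.C a) = toFrac θ (SkewLaurent.C θ (a : K)) := by
  rw [← RatFunc.algebraMap_C, centerFrac_algebraMap, ofCenter_C]

@[simp]
theorem centerFrac_X : centerFrac θ RatFunc.X = toFrac θ (SkewLaurent.X θ ^ orderOf θ) := by
  rw [← RatFunc.algebraMap_X, centerFrac_algebraMap, ofCenter_X]

theorem centerFrac_X_zpow (k : ℤ) :
    centerFrac θ (RatFunc.X ^ k) = toFrac θ (SkewLaurent.monomial θ (orderOf θ * k) 1) := by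
  have hpow (k : ℕ) : centerFrac θ (RatFunc.X ^ k) =
      toFrac θ (SkewLaurent.monomial θ (orderOf θ * k) 1) := by
    rw [map_pow, centerFrac_X, ← map_pow, ← pow_mul, SkewLaurent.X_pow, Nat.cast_mul]
  obtain ⟨k, rfl | rfl⟩ := k.eq_nat_or_neg
  · rw [zpow_natCast, hpow]
  · refine left_inv_eq_right_inv (a := centerFrac θ (RatFunc.X ^ k)) ?_ ?_
    · rw [← map_mul, zpow_neg, zpow_natCast,
        inv_mul_cancel₀ (pow_ne_zero _ RatFunc.X_ne_zero), map_one]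
    · rw [hpow, ← map_mul, SkewLaurent.monomial_mul_monomial, map_one, mul_one, mul_neg,
        add_neg_cancel, ← SkewLaurent.one_def, map_one]

variable {θ}

theorem eq_C_mul_centerFrac {D : (fixedField θ)[X]} (hD : D ≠ 0) {k : ℤ} {a : K} {f : SkewFrac θ}
    (hf : toFrac θ (ofCenter θ D) * f =
      toFrac θ (SkewLaurent.monomial θ (orderOf θ * k) a)) :
    f = toFrac θ (SkewLaurent.C θ a) *
      centerFrac θ (RatFunc.X ^ k / algebraMap _ _ D) := by
  refine (isUnit_toFrac_ofCenter θ D hD).mul_left_cancel ?_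
  rw [hf, ← mul_assoc, ← map_mul, (ofCenter_commute θ D _).eq, map_mul, mul_assoc,
    ← centerFrac_algebraMap, ← map_mul, mul_div_cancel₀ _ (RatFunc.algebraMap_ne_zero hD),
    centerFrac_X_zpow, ← map_mul, C_mul_monomial, mul_one]

theorem mul_C_eq_C_mul {D : (fixedField θ)[X]} (hD : D ≠ 0) {n : ℤ} {a : K} {f : SkewFrac θ}
    (hf : toFrac θ (ofCenter θ D) * f = toFrac θ (SkewLaurent.monomial θ n a)) (b : K) :
    f * toFrac θ (SkewLaurent.C θ b) = toFrac θ (SkewLaurent.C θ ((θ ^ n) b)) * f := by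
  refine (isUnit_toFrac_ofCenter θ D hD).mul_left_cancel ?_
  rw [← mul_assoc, hf, ← mul_assoc, ← map_mul (toFrac θ) (ofCenter θ D),
    (ofCenter_commute θ D _).eq, map_mul, mul_assoc, hf, ← map_mul, ← map_mul, monomial_mul_C,
    C_mul_monomial, mul_comm]

end CentralFractions

section CentralExpansions

variable {K : Type*} [Field K] (θ : RingAut K)

/-- The homomorphism `F((T)) → K((X; θ))`, `T ↦ X^n`, with values in the ambient ring of Laurent
series; the coefficients in `F` act by multiplication. -/
def centerSeries (F : Subfield K) (n : ℕ) (hn : 0 < n) :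
    LaurentSeries F →+* LaurentSeries (Module.End ℤ K) :=
  (HahnSeries.embDomainRingHom (AddMonoidHom.mulLeft (n : ℤ))
    (fun _ _ h => by simpa [hn.ne'] using h) (fun _ _ => by simp [hn])).comp
    (mapSeries (mulEnd.comp F.subtype))

theorem centerSeries_coeff (F : Subfield K) (n : ℕ) (hn : 0 < n) (s : LaurentSeries F) (i : ℤ) :
    (centerSeries F n hn s).coeff (n * i) = mulEnd (s.coeff i : K) :=
  HahnSeries.embDomain_coeff (a := i)

@[simp]
theorem centerSeries_single (F : Subfield K) (n : ℕ) (hn : 0 < n) (i : ℤ) (a : F) :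
    centerSeries F n hn (HahnSeries.single i a) = HahnSeries.single (n * i) (mulEnd (a : K)) := by
  change HahnSeries.embDomain _ (mapSeries (mulEnd.comp F.subtype) (HahnSeries.single i a)) = _
  rw [mapSeries_single, HahnSeries.embDomain_single]
  rfl

theorem toSeriesAux_C (a : K) : toSeriesAux θ (SkewLaurent.C θ a) = HahnSeries.C (mulEnd a) :=
  (toSeriesAux_monomial θ 0 a).trans (by simp [HahnSeries.C_apply])

theorem invertX_C (a : K) : invertX θ (SkewLaurent.C θ a) = SkewLaurent.C θ⁻¹ a :=
  (invertX_monomial θ 0 a).trans (by rw [neg_zero]; rfl)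

theorem coe_taylorZero_toFrac (hθ : IsOfFinOrder θ) (f : SkewLaurent θ) :
    (taylorZero θ hθ (toFrac θ f) : LaurentSeries (Module.End ℤ K)) = toSeriesAux θ f :=
  congrArg Subtype.val (fracLift_toFrac _ _ f)

theorem coe_taylorInfty_toFrac (hθ : IsOfFinOrder θ) (f : SkewLaurent θ) :
    (taylorInfty θ hθ (toFrac θ f) : LaurentSeries (Module.End ℤ K)) =
      toSeriesAux θ⁻¹ (invertX θ f) :=
  congrArg Subtype.val (fracLift_toFrac _ _ f)

theorem coe_taylorZero_centerFrac (hθ : IsOfFinOrder θ) (h : RatFunc (fixedField θ)) :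
    (taylorZero θ hθ (centerFrac θ h) : LaurentSeries (Module.End ℤ K)) =
      centerSeries (fixedField θ) (orderOf θ) hθ.orderOf_pos (expandAt 0 h) := by
  refine DFunLike.congr_fun (ratFunc_ringHom_ext
    (φ := ((SkewLaurentSeries θ).subtype.comp (taylorZero θ hθ)).comp (centerFrac θ))
    (ψ := (centerSeries _ _ hθ.orderOf_pos).comp (expandAt 0)) (fun a => ?_) ?_) h
  · simp [coe_taylorZero_toFrac, toSeriesAux_C, HahnSeries.C_apply]
  · simp [coe_taylorZero_toFrac, SkewLaurent.X_pow, toSeriesAux_monomial, pow_orderOf_eq_one,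
      -map_pow]

theorem coe_taylorInfty_centerFrac (hθ : IsOfFinOrder θ) (h : RatFunc (fixedField θ)) :
    (taylorInfty θ hθ (centerFrac θ h) : LaurentSeries (Module.End ℤ K)) =
      centerSeries (fixedField θ) (orderOf θ) hθ.orderOf_pos (expandInfty _ h) := by
  refine DFunLike.congr_fun (ratFunc_ringHom_ext
    (φ := ((SkewLaurentSeries θ⁻¹).subtype.comp (taylorInfty θ hθ)).comp (centerFrac θ))
    (ψ := (centerSeries _ _ hθ.orderOf_pos).comp (expandInfty _)) (fun a => ?_) ?_) h
  · simp [coe_taylorInfty_toFrac, invertX_C, toSeriesAux_C, HahnSeries.C_apply]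
  · simp [coe_taylorInfty_toFrac, SkewLaurent.X_pow, invertX_monomial, toSeriesAux_monomial,
      pow_orderOf_eq_one, -map_pow]

/-- The homomorphism `F[Y]/N → 𝒜/N𝒜`, `Y ↦ X^r`. -/
def centerQuot (N : (fixedField θ)[X]) : AdjoinRoot N →+* SkewQuot θ N :=
  Ideal.quotientMap (I := Ideal.span {N}) (skewIdeal θ N) (ofCenter θ)
    ((Ideal.span_singleton_le_iff_mem _).2 (Ideal.mem_span_singleton_self _))

theorem centerQuot_mk (N p : (fixedField θ)[X]) :
    centerQuot θ N (AdjoinRoot.mk N p) = Ideal.Quotient.mk _ (ofCenter θ p) := rfl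

@[simp]
theorem centerQuot_of (N : (fixedField θ)[X]) (a : fixedField θ) :
    centerQuot θ N (AdjoinRoot.of N a) = Ideal.Quotient.mk _ (SkewLaurent.C θ (a : K)) := by
  rw [← ofCenter_C]; rfl

@[simp]
theorem centerQuot_root (N : (fixedField θ)[X]) :
    centerQuot θ N (AdjoinRoot.root N) = Ideal.Quotient.mk _ (SkewLaurent.X θ ^ orderOf θ) := by
  rw [← ofCenter_X]; rfl

variable {θ} {Fs : Type*} [Field Fs] [Algebra (fixedField θ) Fs]

theorem AdmissibleMorphism.taylor_C [IsSepClosure (fixedField θ) Fs] {z : Fs}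
    (τ : AdmissibleMorphism θ z) (a : K) :
    τ.taylor (toFrac θ (SkewLaurent.C θ a)) =
      HahnSeries.C (Ideal.Quotient.mk _ (SkewLaurent.C θ a)) := by
  rw [AdmissibleMorphism.taylor, fracLift_toFrac, AdmissibleMorphism.toLaurentSeries,
    RingHom.comp_apply, RingHom.comp_apply, τ.map_C, HahnSeries.ofPowerSeries_C]

theorem AdmissibleMorphism.taylor_X_pow_orderOf [IsSepClosure (fixedField θ) Fs] {z : Fs}
    (τ : AdmissibleMorphism θ z) :
    τ.taylor (toFrac θ (SkewLaurent.X θ ^ orderOf θ)) =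
      HahnSeries.C (Ideal.Quotient.mk _ (SkewLaurent.X θ ^ orderOf θ)) +
        HahnSeries.single 1 1 := by
  rw [AdmissibleMorphism.taylor, fracLift_toFrac, AdmissibleMorphism.toLaurentSeries,
    RingHom.comp_apply, RingHom.comp_apply, τ.map_Y, map_add, HahnSeries.ofPowerSeries_C,
    HahnSeries.ofPowerSeries_X]

theorem AdmissibleMorphism.taylor_centerFrac [IsSepClosure (fixedField θ) Fs] {z : Fs}
    (τ : AdmissibleMorphism θ z) [Fact (Irreducible (minpoly (fixedField θ) z))]
    (h : RatFunc (fixedField θ)) :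
    τ.taylor (centerFrac θ h) = mapSeries (centerQuot θ _)
      (expandAt (AdjoinRoot.root (minpoly (fixedField θ) z)) (mapRatFunc (AdjoinRoot.of _) h)) := by
  have hcomp : τ.taylor.comp (centerFrac θ) =
      (mapSeries (centerQuot θ (minpoly (fixedField θ) z))).comp
        ((expandAt (AdjoinRoot.root _)).comp (mapRatFunc (AdjoinRoot.of _))) := by
    refine ratFunc_ringHom_ext (fun a => ?_) ?_
    · simp [τ.taylor_C]
    · simp [τ.taylor_X_pow_orderOf, -map_pow]
  exact DFunLike.congr_fun hcomp h

end CentralExpansions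

section CoefficientsAndConstants

variable {K : Type*} [Field K] (θ : RingAut K)

theorem coeff_toSeries_C_mul (s : SkewLaurentSeries θ) (a : K) (i : ℤ) :
    SkewLaurentSeries.coeff θ i (toSeries θ (SkewLaurent.C θ a) * s) =
      a * SkewLaurentSeries.coeff θ i s := by
  change (toSeriesAux θ (SkewLaurent.C θ a) * (s : LaurentSeries (Module.End ℤ K))).coeff i 1 =
    a * (s : LaurentSeries (Module.End ℤ K)).coeff i 1
  rw [toSeriesAux_C, HahnSeries.C_apply, HahnSeries.coeff_single_zero_mul]
  rfl

theorem coeff_mul_toSeries_C (s : SkewLaurentSeries θ) (b : K) (i : ℤ) :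
    SkewLaurentSeries.coeff θ i (s * toSeries θ (SkewLaurent.C θ b)) =
      (θ ^ i) b * SkewLaurentSeries.coeff θ i s := by
  obtain ⟨c, hc⟩ := s.2 i
  change ((s : LaurentSeries (Module.End ℤ K)) * toSeriesAux θ (SkewLaurent.C θ b)).coeff i 1 =
    _ * (s : LaurentSeries (Module.End ℤ K)).coeff i 1
  rw [toSeriesAux_C, HahnSeries.C_apply, HahnSeries.coeff_mul_single_zero, hc]
  change c * (θ ^ i) (b * 1) = (θ ^ i) b * (c * (θ ^ i) 1)
  rw [mul_one, map_one, mul_one, mul_comm]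

theorem sec_C_mul (j : ℤ) (a : K) (f : SkewLaurent θ) :
    sec θ j (SkewLaurent.C θ a * f) = LaurentPolynomial.C a * sec θ j f := by
  induction f using SkewLaurent.induction_on with
  | h0 => simp
  | ha f g hf hg => rw [mul_add, map_add, hf, hg, map_add, mul_add]
  | hm n b =>
    rw [C_mul_monomial, sec_monomial, sec_monomial]
    split_ifs
    · rw [map_mul, mul_assoc]
    · rw [mul_zero]

theorem sec_mul_C (j : ℤ) (f : SkewLaurent θ) (b : K) :
    sec θ j (f * SkewLaurent.C θ b) = LaurentPolynomial.C ((θ ^ j) b) * sec θ j f := by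
  induction f using SkewLaurent.induction_on with
  | h0 => simp
  | ha f g hf hg => rw [add_mul, map_add, hf, hg, map_add, mul_add]
  | hm n a =>
    rw [monomial_mul_C, sec_monomial, sec_monomial]
    split_ifs with hn
    · have hnj : θ ^ n = θ ^ j := by
        rw [← sub_add_cancel n j, zpow_add, orderOf_dvd_iff_zpow_eq_one.1 hn, one_mul]
      rw [hnj, mul_comm a, map_mul, mul_assoc]
    · rw [mul_zero]

theorem sec_zero_one : sec θ 0 1 = 1 := by
  rw [SkewLaurent.one_def, sec_monomial]
  simp

end CoefficientsAndConstants

section PartialSkewResidues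

variable {K : Type*} [Field K] {θ : RingAut K} {Fs : Type*} [Field Fs]
  [Algebra (fixedField θ) Fs] (hθ : IsOfFinOrder θ)

theorem iota_mk_C (z : Fs) (hz : z ≠ 0) (a : K) :
    iota θ z hz (Ideal.Quotient.mk _ (LaurentPolynomial.C a)) = a ⊗ₜ 1 :=
  LaurentPolynomial.eval₂_C _ _ a

theorem iota_mk_toLaurent (z : Fs) (hz : z ≠ 0) (p : (fixedField θ)[X]) :
    iota θ z hz (Ideal.Quotient.mk _ (toLaurent θ p)) = 1 ⊗ₜ Polynomial.aeval z p := by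
  have hcomp : Algebra.TensorProduct.includeLeftRingHom.comp (fixedField θ).subtype =
      algebraMap (fixedField θ) (K ⊗[fixedField θ] Fs) := rfl
  rw [iota, Ideal.Quotient.lift_mk, toLaurent, RingHom.comp_apply,
    LaurentPolynomial.eval₂_toLaurent, Polynomial.coe_mapRingHom, Polynomial.eval₂_map, hcomp,
    ← Polynomial.aeval_def]
  exact Polynomial.aeval_algHom_apply
    (Algebra.TensorProduct.includeRight : Fs →ₐ[fixedField θ] K ⊗[fixedField θ] Fs) z p

theorem iota_secQuot_C_mul (j : ℤ) (z : Fs) (hz : z ≠ 0) (a : K)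
    (u : SkewQuot θ (minpoly (fixedField θ) z)) :
    iota θ z hz (secQuot θ hθ j _ (Ideal.Quotient.mk _ (SkewLaurent.C θ a) * u)) =
      a ⊗ₜ 1 * iota θ z hz (secQuot θ hθ j _ u) := by
  obtain ⟨f, rfl⟩ := Ideal.Quotient.mk_surjective u
  change iota θ z hz (Ideal.Quotient.mk _ (sec θ j (SkewLaurent.C θ a * f))) = _
  rw [sec_C_mul, map_mul, map_mul, iota_mk_C]
  rfl

theorem iota_secQuot_mul_C (j : ℤ) (z : Fs) (hz : z ≠ 0) (b : K)
    (u : SkewQuot θ (minpoly (fixedField θ) z)) :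
    iota θ z hz (secQuot θ hθ j _ (u * Ideal.Quotient.mk _ (SkewLaurent.C θ b))) =
      (θ ^ j) b ⊗ₜ 1 * iota θ z hz (secQuot θ hθ j _ u) := by
  obtain ⟨f, rfl⟩ := Ideal.Quotient.mk_surjective u
  change iota θ z hz (Ideal.Quotient.mk _ (sec θ j (f * SkewLaurent.C θ b))) = _
  rw [sec_mul_C, map_mul, map_mul, iota_mk_C]
  rfl

/-- The embedding `F[Y]/N → F^s`, `Y ↦ z`, where `N` is the minimal polynomial of `z`. -/
def evalRoot (z : Fs) : AdjoinRoot (minpoly (fixedField θ) z) →+* Fs :=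
  AdjoinRoot.lift (algebraMap (fixedField θ) Fs) z (minpoly.aeval (fixedField θ) z)

theorem evalRoot_mk (z : Fs) (p : (fixedField θ)[X]) :
    evalRoot z (AdjoinRoot.mk _ p) = Polynomial.aeval z p := AdjoinRoot.lift_mk _ _

theorem evalRoot_root (z : Fs) :
    evalRoot z (AdjoinRoot.root (minpoly (fixedField θ) z)) = z := AdjoinRoot.lift_root _

theorem evalRoot_comp_of (z : Fs) :
    (evalRoot z).comp (AdjoinRoot.of (minpoly (fixedField θ) z)) =
      algebraMap (fixedField θ) Fs := AdjoinRoot.lift_comp_of _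

theorem iota_secQuot_centerQuot (z : Fs) (hz : z ≠ 0)
    (u : AdjoinRoot (minpoly (fixedField θ) z)) :
    iota θ z hz (secQuot θ hθ 0 _ (centerQuot θ _ u)) = 1 ⊗ₜ evalRoot z u := by
  induction u using AdjoinRoot.induction_on with
  | ih p =>
    rw [centerQuot_mk, evalRoot_mk, ← iota_mk_toLaurent z hz]
    change iota θ z hz (Ideal.Quotient.mk _ (sec θ 0 (ofCenter θ p))) = _
    rw [← one_mul (ofCenter θ p), sec_mul_ofCenter θ hθ, sec_zero_one, one_mul]

variable [IsSepClosure (fixedField θ) Fs] (τ : ∀ z : Fs, z ≠ 0 → AdmissibleMorphism θ z)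

theorem partialSkewResidue_infty (j : ℤ) (f : SkewFrac θ) :
    partialSkewResidue θ hθ τ j f ∞ =
      (-SkewLaurentSeries.coeff θ⁻¹ (orderOf θ - j) (taylorInfty θ hθ f)) ⊗ₜ 1 := rfl

theorem partialSkewResidue_zero (j : ℤ) (f : SkewFrac θ) :
    partialSkewResidue θ hθ τ j f ((0 : Fs) : OnePoint Fs) =
      SkewLaurentSeries.coeff θ (j - orderOf θ) (taylorZero θ hθ f) ⊗ₜ 1 :=
  dif_pos rfl

theorem partialSkewResidue_of_ne_zero (j : ℤ) (f : SkewFrac θ) {z : Fs} (hz : z ≠ 0) :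
    partialSkewResidue θ hθ τ j f (z : OnePoint Fs) =
      iota θ z hz (secQuot θ hθ j _ (((τ z hz).taylor f).coeff (-1))) :=
  dif_neg hz

theorem partialSkewResidue_add (j : ℤ) (f g : SkewFrac θ) :
    partialSkewResidue θ hθ τ j (f + g) =
      partialSkewResidue θ hθ τ j f + partialSkewResidue θ hθ τ j g := by
  funext z
  rw [Pi.add_apply]
  cases z with
  | infty => simp only [partialSkewResidue_infty, map_add, neg_add, TensorProduct.add_tmul]
  | coe z =>
    rcases eq_or_ne z 0 with rfl | hz
    · simp only [partialSkewResidue_zero, map_add, TensorProduct.add_tmul]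
    · simp only [partialSkewResidue_of_ne_zero hθ τ j _ hz, map_add, HahnSeries.coeff_add]

theorem partialSkewResidue_C_mul (j : ℤ) (a : K) (f : SkewFrac θ) (z : OnePoint Fs) :
    partialSkewResidue θ hθ τ j (toFrac θ (SkewLaurent.C θ a) * f) z =
      a ⊗ₜ 1 * partialSkewResidue θ hθ τ j f z := by
  cases z with
  | infty =>
    rw [partialSkewResidue_infty, partialSkewResidue_infty, map_mul, taylorInfty, fracLift_toFrac,
      RingHom.comp_apply, invertX_C, coeff_toSeries_C_mul, Algebra.TensorProduct.tmul_mul_tmul,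
      mul_neg, one_mul]
  | coe z =>
    rcases eq_or_ne z 0 with rfl | hz
    · rw [partialSkewResidue_zero, partialSkewResidue_zero, map_mul, taylorZero, fracLift_toFrac,
        coeff_toSeries_C_mul, Algebra.TensorProduct.tmul_mul_tmul, one_mul]
    · rw [partialSkewResidue_of_ne_zero hθ τ j _ hz, partialSkewResidue_of_ne_zero hθ τ j _ hz,
        map_mul, (τ z hz).taylor_C, HahnSeries.C_apply, HahnSeries.coeff_single_zero_mul,
        iota_secQuot_C_mul]

theorem partialSkewResidue_mul_C (j : ℤ) (f : SkewFrac θ) (b : K) (z : OnePoint Fs) :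
    partialSkewResidue θ hθ τ j (f * toFrac θ (SkewLaurent.C θ b)) z =
      (θ ^ j) b ⊗ₜ 1 * partialSkewResidue θ hθ τ j f z := by
  have hr : θ ^ (orderOf θ : ℤ) = 1 := by rw [zpow_natCast, pow_orderOf_eq_one]
  cases z with
  | infty =>
    have hj : (θ⁻¹ : RingAut K) ^ (orderOf θ - j) = θ ^ j := by
      rw [inv_zpow', neg_sub, zpow_sub, hr, inv_one, mul_one]
    rw [partialSkewResidue_infty, partialSkewResidue_infty, map_mul, taylorInfty, fracLift_toFrac,
      RingHom.comp_apply, invertX_C, coeff_mul_toSeries_C, hj,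
      Algebra.TensorProduct.tmul_mul_tmul, mul_neg, one_mul]
  | coe z =>
    rcases eq_or_ne z 0 with rfl | hz
    · have hj : θ ^ (j - orderOf θ) = θ ^ j := by rw [zpow_sub, hr, inv_one, mul_one]
      rw [partialSkewResidue_zero, partialSkewResidue_zero, map_mul, taylorZero, fracLift_toFrac,
        coeff_mul_toSeries_C, hj, Algebra.TensorProduct.tmul_mul_tmul, one_mul]
    · rw [partialSkewResidue_of_ne_zero hθ τ j _ hz, partialSkewResidue_of_ne_zero hθ τ j _ hz,
        map_mul, (τ z hz).taylor_C, HahnSeries.C_apply, HahnSeries.coeff_mul_single_zero,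
        iota_secQuot_mul_C]

theorem partialSkewResidue_centerFrac (h : RatFunc (fixedField θ)) (z : OnePoint Fs) :
    partialSkewResidue θ hθ τ 0 (centerFrac θ h) z =
      1 ⊗ₜ residue (mapRatFunc (algebraMap (fixedField θ) Fs) h) z := by
  have hcoe (c : fixedField θ) :
      (c : K) ⊗ₜ[fixedField θ] (1 : Fs) = 1 ⊗ₜ algebraMap (fixedField θ) Fs c := by
    rw [Algebra.algebraMap_eq_smul_one, ← TensorProduct.smul_tmul, Subfield.smul_def, smul_eq_mul,
      mul_one]
  cases z with
  | infty =>
    have hcoeff : SkewLaurentSeries.coeff θ⁻¹ (orderOf θ - 0) (taylorInfty θ hθ (centerFrac θ h)) =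
        ((expandInfty _ h).coeff 1 : fixedField θ) := by
      change (taylorInfty θ hθ (centerFrac θ h) : LaurentSeries (Module.End ℤ K)).coeff _ 1 = _
      rw [coe_taylorInfty_centerFrac, sub_zero, ← mul_one (orderOf θ : ℤ), centerSeries_coeff]
      exact mul_one _
    rw [partialSkewResidue_infty, hcoeff, residue_mapRatFunc_infty, residue_infty, ← hcoe,
      NegMemClass.coe_neg]
  | coe z =>
    rcases eq_or_ne z 0 with rfl | hz
    · have hcoeff : SkewLaurentSeries.coeff θ (0 - orderOf θ) (taylorZero θ hθ (centerFrac θ h)) =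
          ((expandAt 0 h).coeff (-1) : fixedField θ) := by
        change (taylorZero θ hθ (centerFrac θ h) : LaurentSeries (Module.End ℤ K)).coeff _ 1 = _
        rw [coe_taylorZero_centerFrac, zero_sub, ← mul_neg_one, centerSeries_coeff]
        exact mul_one _
      rw [partialSkewResidue_zero, hcoeff, hcoe, ← residue_coe, ← residue_mapRatFunc_coe, map_zero]
    · have : Algebra.IsSeparable (fixedField θ) Fs := IsSepClosure.separable
      have : Fact (Irreducible (minpoly (fixedField θ) z)) :=
        ⟨minpoly.irreducible (Algebra.IsIntegral.isIntegral z)⟩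
      rw [partialSkewResidue_of_ne_zero hθ τ 0 _ hz, (τ z hz).taylor_centerFrac, mapSeries_coeff,
        iota_secQuot_centerQuot, ← residue_coe, ← residue_mapRatFunc_coe, mapRatFunc_mapRatFunc,
        evalRoot_root, evalRoot_comp_of]

theorem partialSkewResidue_eq_zero_of_mul_C_eq {f : SkewFrac θ} {b c : K} (hbc : b ≠ c)
    (hf : f * toFrac θ (SkewLaurent.C θ b) = toFrac θ (SkewLaurent.C θ c) * f) :
    partialSkewResidue θ hθ τ 0 f = 0 := by
  funext z
  have hmul := congrFun (congrArg (partialSkewResidue θ hθ τ 0) hf) z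
  rw [partialSkewResidue_mul_C, partialSkewResidue_C_mul, zpow_zero, RingAut.one_apply,
    ← sub_eq_zero, ← sub_mul, ← TensorProduct.sub_tmul] at hmul
  have hunit : IsUnit ((b - c) ⊗ₜ[fixedField θ] (1 : Fs)) :=
    (IsUnit.mk0 (b - c) (sub_ne_zero.2 hbc)).map Algebra.TensorProduct.includeLeftRingHom
  exact hunit.mul_right_eq_zero.1 hmul

theorem hasZeroSum_partialSkewResidue_of_monomial {D : (fixedField θ)[X]} (hD : D ≠ 0)
    (hs : (D.map (algebraMap (fixedField θ) Fs)).Splits) (n : ℤ) (a : K) {f : SkewFrac θ}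
    (hf : toFrac θ (ofCenter θ D) * f = toFrac θ (SkewLaurent.monomial θ n a)) :
    HasZeroSum (partialSkewResidue θ hθ τ 0 f) := by
  by_cases hn : (orderOf θ : ℤ) ∣ n
  · obtain ⟨k, rfl⟩ := hn
    have hres (z : OnePoint Fs) : partialSkewResidue θ hθ τ 0 f z =
        a ⊗ₜ residue
          (RatFunc.X ^ k / algebraMap Fs[X] (RatFunc Fs) (D.map (algebraMap _ Fs))) z := by
      rw [eq_C_mul_centerFrac hD hf, partialSkewResidue_C_mul, partialSkewResidue_centerFrac,
        Algebra.TensorProduct.tmul_mul_tmul, mul_one, one_mul, map_div₀,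
        map_zpow₀, mapRatFunc_algebraMap, mapRatFunc_X]
    rw [funext hres]
    exact (hasZeroSum_residue_zpow_div k hs).map
      (TensorProduct.mk (fixedField θ) K Fs a).toAddMonoidHom
  · obtain ⟨b, hb⟩ : ∃ b, (θ ^ n) b ≠ b := by
      by_contra! hfix
      exact hn (orderOf_dvd_iff_zpow_eq_one.2 (RingEquiv.ext hfix))
    rw [partialSkewResidue_eq_zero_of_mul_C_eq hθ τ hb.symm (mul_C_eq_C_mul hD hf b)]
    exact HasZeroSum.zero

theorem hasZeroSum_partialSkewResidue {f : SkewFrac θ} (hf : PolesIn θ Fs f) :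
    HasZeroSum (partialSkewResidue θ hθ τ 0 f) := by
  obtain ⟨D, hD, hs, g, hg⟩ := hf
  induction g using SkewLaurent.induction_on generalizing f with
  | h0 =>
    rw [← map_zero (SkewLaurent.monomial θ 0)] at hg
    exact hasZeroSum_partialSkewResidue_of_monomial hθ τ hD hs 0 0 hg
  | hm n a => exact hasZeroSum_partialSkewResidue_of_monomial hθ τ hD hs n a hg
  | ha g₁ g₂ h₁ h₂ =>
    obtain ⟨f₁, hf₁⟩ : ∃ f₁, toFrac θ (ofCenter θ D) * f₁ = toFrac θ g₁ :=
      (isUnit_toFrac_ofCenter θ D hD).dvd.imp fun _ => Eq.symm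
    have hf₂ : toFrac θ (ofCenter θ D) * (f - f₁) = toFrac θ g₂ := by
      rw [mul_sub, hg, hf₁, map_add, add_sub_cancel_left]
    rw [← add_sub_cancel f₁ f, partialSkewResidue_add]
    exact (h₁ hf₁).add (h₂ hf₂)

end PartialSkewResidues

section NormPolynomial

variable {K : Type*} [Field K] {θ : RingAut K}

theorem exists_sum_range_orderOf_ne_zero (hθ : IsOfFinOrder θ) :
    ∃ a : K, ∑ i ∈ Finset.range (orderOf θ), (θ ^ i) a ≠ 0 := by
  -- Dedekind's independence of characters, applied to the distinct automorphisms `θⁱ`.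
  by_contra! hsum
  let χ (i : Fin (orderOf θ)) : K →* K := ((θ ^ (i : ℕ) : RingAut K) : K →+* K)
  have hχ : Function.Injective χ := fun i j hij =>
    Fin.ext (pow_injOn_Iio_orderOf i.2 j.2 (RingEquiv.ext fun x => DFunLike.congr_fun hij x))
  have hzero : ∑ i, (1 : K) • (⇑(χ i) : K → K) = 0 := by
    funext x
    rw [Finset.sum_apply, Pi.zero_apply, ← hsum x, ← Fin.sum_univ_eq_sum_range fun i => (θ ^ i) x]
    exact Finset.sum_congr rfl fun i _ => one_mul _
  exact one_ne_zero (Fintype.linearIndependent_iff.1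
    ((linearIndependent_monoidHom K K).comp χ hχ) (fun _ => 1) hzero ⟨0, hθ.orderOf_pos⟩)

variable (θ) in
/-- The polynomial `∏_{i < n} (1 + θⁱ(a) S)`. For `n` the order of `θ`, it is the norm of
`1 + a S` to `F[S]`. -/
def normPoly (a : K) (n : ℕ) : K[X] :=
  ∏ i ∈ Finset.range n, (1 + Polynomial.C ((θ ^ i) a) * Polynomial.X)

theorem normPoly_succ (a : K) (n : ℕ) :
    normPoly θ a (n + 1) =
      normPoly θ a n * (1 + Polynomial.C ((θ ^ n) a) * Polynomial.X) :=
  Finset.prod_range_succ _ _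

theorem normPoly_coeff_zero (a : K) (n : ℕ) : (normPoly θ a n).coeff 0 = 1 := by
  rw [normPoly, Polynomial.coeff_zero_prod]
  simp

theorem normPoly_coeff_one (a : K) (n : ℕ) :
    (normPoly θ a n).coeff 1 = ∑ i ∈ Finset.range n, (θ ^ i) a := by
  induction n with
  | zero => simp [normPoly, Polynomial.coeff_one]
  | succ n ih =>
    rw [Finset.sum_range_succ, ← ih, normPoly_succ, Polynomial.mul_coeff_one, normPoly_coeff_zero]
    simp [Polynomial.coeff_one, add_comm]

theorem map_normPoly_orderOf (a : K) :
    (normPoly θ a (orderOf θ)).map (θ : K →+* K) = normPoly θ a (orderOf θ) := by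
  have hmap (i : ℕ) : (θ : K →+* K) ((θ ^ i) a) = (θ ^ (i + 1)) a :=
    (congrFun (congrArg DFunLike.coe (pow_succ' θ i)) a).symm
  have hperiod : (θ ^ orderOf θ) a = (θ ^ 0) a := by rw [pow_orderOf_eq_one, pow_zero]
  simp only [normPoly, Polynomial.map_prod, Polynomial.map_add, Polynomial.map_one,
    Polynomial.map_mul, Polynomial.map_C, Polynomial.map_X, hmap]
  rcases hr : orderOf θ with _ | n
  · simp only [Finset.range_zero, Finset.prod_empty]
  · rw [hr] at hperiod
    rw [Finset.prod_range_succ, Finset.prod_range_succ', hperiod]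

theorem exists_map_eq_normPoly (a : K) :
    ∃ P : (fixedField θ)[X], P.map (fixedField θ).subtype = normPoly θ a (orderOf θ) := by
  refine (Polynomial.mem_lifts _).1 ((Polynomial.lifts_iff_coeff_lifts _).2 fun n => ?_)
  refine ⟨⟨(normPoly θ a (orderOf θ)).coeff n, ?_⟩, rfl⟩
  exact (Polynomial.coeff_map (θ : K →+* K) n).symm.trans
    (congrArg (Polynomial.coeff · n) (map_normPoly_orderOf a))

theorem exists_aeval_eq_one_add_X {F : Type*} [Field F] (P : F[X]) (h0 : P.coeff 0 = 1)
    (h1 : P.coeff 1 ≠ 0) : ∃ G : PowerSeries F, PowerSeries.constantCoeff G = 0 ∧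
      Polynomial.aeval G P = 1 + PowerSeries.X := by
  have hcoeff : PowerSeries.coeff 1 ((P - 1 : F[X]) : PowerSeries F) = P.coeff 1 := by
    rw [Polynomial.coeff_coe, Polynomial.coeff_sub, Polynomial.coeff_one, if_neg one_ne_zero,
      sub_zero]
  let : Invertible (PowerSeries.coeff 1 ((P - 1 : F[X]) : PowerSeries F)) :=
    invertibleOfNonzero (hcoeff ▸ h1)
  have hsubst := PowerSeries.subst_substInv_right ((P - 1 : F[X]) : PowerSeries F)
    (by rw [← PowerSeries.coeff_zero_eq_constantCoeff_apply, Polynomial.coeff_coe]; simp [h0])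
  rw [PowerSeries.subst_coe (PowerSeries.HasSubst.substInv _), map_sub, map_one,
    sub_eq_iff_eq_add'] at hsubst
  exact ⟨_, PowerSeries.constantCoeff_substInv _, hsubst⟩

theorem pow_mul_eq_of_mul_eq {R : Type*} [Ring R] (c : K →+* R) {x : R}
    (hxc : ∀ b, x * c b = c (θ b) * x) (n : ℕ) (b : K) :
    x ^ n * c b = c ((θ ^ n) b) * x ^ n := by
  induction n with
  | zero => simp
  | succ n ih => rw [pow_succ', mul_assoc, ih, ← mul_assoc, hxc, mul_assoc, pow_succ' θ]; rfl

theorem one_add_mul_mul_pow {R : Type*} [Ring R] (c : K →+* R) {g x : R}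
    (hcg : ∀ b, Commute (c b) g) (hgx : Commute g x) (hxc : ∀ b, x * c b = c (θ b) * x)
    (a : K) (n : ℕ) :
    ((1 + c a * g) * x) ^ n = Polynomial.eval₂RingHom' c g hcg (normPoly θ a n) * x ^ n := by
  induction n with
  | zero => simp [normPoly]
  | succ n ih =>
    have hxn : x ^ n * (1 + c a * g) = (1 + c ((θ ^ n) a) * g) * x ^ n := by
      rw [mul_add, mul_one, ← mul_assoc, pow_mul_eq_of_mul_eq c hxc, mul_assoc,
        ← (hgx.pow_right n).eq, ← mul_assoc, add_mul, one_mul]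
    have hfactor : Polynomial.eval₂RingHom' c g hcg
        (1 + Polynomial.C ((θ ^ n) a) * Polynomial.X) = 1 + c ((θ ^ n) a) * g := by
      rw [map_add, map_one, map_mul]
      exact congrArg₂ (1 + · * ·) (Polynomial.eval₂_C _ _) (Polynomial.eval₂_X _ _)
    rw [pow_succ, ih, normPoly_succ, map_mul, hfactor, mul_assoc, ← mul_assoc (x ^ n), hxn,
      mul_assoc, mul_assoc, pow_succ]

end NormPolynomial

section Deformation

variable {K : Type*} [Field K] (θ : RingAut K)

theorem commute_monomial_neg_orderOf (f : SkewLaurent θ) :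
    Commute (SkewLaurent.monomial θ (-orderOf θ) 1) f := by
  induction f using SkewLaurent.induction_on with
  | h0 => exact Commute.zero_right _
  | ha f g hf hg => exact hf.add_right hg
  | hm n b =>
    rw [Commute, SemiconjBy, SkewLaurent.monomial_mul_monomial, SkewLaurent.monomial_mul_monomial,
      zpow_neg, zpow_natCast, pow_orderOf_eq_one, inv_one, map_one, RingAut.one_apply, one_mul,
      mul_one, add_comm]

theorem isUnit_X : IsUnit (SkewLaurent.X θ) :=
  isUnit_iff_exists.2 ⟨SkewLaurent.monomial θ (-1) 1, by
    simp [SkewLaurent.X, SkewLaurent.monomial_mul_monomial, SkewLaurent.one_def]⟩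

theorem X_mul_C (b : K) :
    SkewLaurent.X θ * SkewLaurent.C θ b = SkewLaurent.C θ (θ b) * SkewLaurent.X θ := by
  change SkewLaurent.monomial θ 1 1 * SkewLaurent.monomial θ 0 b =
    SkewLaurent.monomial θ 0 (θ b) * SkewLaurent.monomial θ 1 1
  rw [SkewLaurent.monomial_mul_monomial, SkewLaurent.monomial_mul_monomial]
  simp

/-- The embedding `F[Y] → 𝒜`, `Y ↦ X⁻ʳ`. -/
def ofCenterInv : (fixedField θ)[X] →+* SkewLaurent θ :=
  Polynomial.eval₂RingHom' ((SkewLaurent.C θ).comp (fixedField θ).subtype)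
    (SkewLaurent.monomial θ (-orderOf θ) 1) fun _ => (commute_monomial_neg_orderOf θ _).symm

theorem ofCenterInv_C (c : fixedField θ) :
    ofCenterInv θ (Polynomial.C c) = SkewLaurent.C θ c := Polynomial.eval₂_C _ _

theorem ofCenterInv_X :
    ofCenterInv θ Polynomial.X = SkewLaurent.monomial θ (-orderOf θ) 1 := Polynomial.eval₂_X _ _

theorem ofCenterInv_commute (p : (fixedField θ)[X]) (f : SkewLaurent θ) :
    Commute (ofCenterInv θ p) f := by
  induction p using Polynomial.induction_on with
  | C c =>
    rw [ofCenterInv_C, ← ofCenter_C]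
    exact ofCenter_commute θ _ f
  | add p q hp hq => rw [map_add]; exact hp.add_left hq
  | monomial n c h =>
    rw [pow_succ, ← mul_assoc, map_mul, ofCenterInv_X]
    exact h.mul_left (commute_monomial_neg_orderOf θ f)

/-- The substitution `F[[T]] → 𝒜[[T]]`, `T ↦ Y⁻¹ T`. -/
def dilate : PowerSeries (fixedField θ) →+* PowerSeries (SkewLaurent θ) :=
  (PowerSeries.map (ofCenterInv θ)).comp
    ((PowerSeries.rescale Polynomial.X).comp (PowerSeries.map Polynomial.C))

theorem coeff_dilate (n : ℕ) (G : PowerSeries (fixedField θ)) :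
    PowerSeries.coeff n (dilate θ G) =
      ofCenterInv θ (Polynomial.X ^ n * Polynomial.C (PowerSeries.coeff n G)) := by
  rw [dilate, RingHom.comp_apply, RingHom.comp_apply, PowerSeries.coeff_map,
    PowerSeries.coeff_rescale, PowerSeries.coeff_map]

theorem dilate_C (c : fixedField θ) :
    dilate θ (PowerSeries.C c) = PowerSeries.C (SkewLaurent.C θ c) := by
  ext n
  rw [coeff_dilate, PowerSeries.coeff_C, PowerSeries.coeff_C]
  split_ifs with hn <;> simp [hn, ofCenterInv_C]

theorem dilate_X :
    dilate θ PowerSeries.X =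
      PowerSeries.C (SkewLaurent.monomial θ (-orderOf θ) 1) * PowerSeries.X := by
  simp [dilate, PowerSeries.rescale_X, ofCenterInv_X]

theorem dilate_one_add_X_mul :
    dilate θ (1 + PowerSeries.X) * PowerSeries.C (SkewLaurent.X θ ^ orderOf θ) =
      PowerSeries.C (SkewLaurent.X θ ^ orderOf θ) + PowerSeries.X := by
  have hinv : SkewLaurent.monomial θ (-orderOf θ) 1 * SkewLaurent.X θ ^ orderOf θ = 1 := by
    simp [SkewLaurent.X_pow, SkewLaurent.monomial_mul_monomial, SkewLaurent.one_def]
  rw [map_add, map_one, dilate_X, add_mul, one_mul, mul_assoc,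
    ← (PowerSeries.commute_X (PowerSeries.C (SkewLaurent.X θ ^ orderOf θ))).eq, ← mul_assoc,
    ← map_mul, hinv, map_one, one_mul]

theorem constantCoeff_dilate {G : PowerSeries (fixedField θ)}
    (hG : PowerSeries.constantCoeff G = 0) : PowerSeries.constantCoeff (dilate θ G) = 0 := by
  rw [← PowerSeries.coeff_zero_eq_constantCoeff_apply] at hG ⊢
  rw [coeff_dilate, hG, map_zero, mul_zero, map_zero]

theorem dilate_commute_C (G : PowerSeries (fixedField θ)) (f : SkewLaurent θ) :
    Commute (dilate θ G) (PowerSeries.C f) := by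
  ext n
  rw [PowerSeries.coeff_mul_C, PowerSeries.coeff_C_mul]
  exact ofCenterInv_commute θ _ f

/-- The element `(1 + a G(Y⁻¹ T)) X` of `𝒜[[T]]`, the image of `X` under a deformation of the
inclusion `𝒜 → 𝒜[[T]]`. -/
def deformX (a : K) (G : PowerSeries (fixedField θ)) : PowerSeries (SkewLaurent θ) :=
  (1 + PowerSeries.C (SkewLaurent.C θ a) * dilate θ G) * PowerSeries.C (SkewLaurent.X θ)

theorem constantCoeff_deformX (a : K) {G : PowerSeries (fixedField θ)}
    (hG : PowerSeries.constantCoeff G = 0) :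
    PowerSeries.constantCoeff (deformX θ a G) = SkewLaurent.X θ := by
  simp [deformX, constantCoeff_dilate θ hG]

theorem isUnit_deformX (a : K) {G : PowerSeries (fixedField θ)}
    (hG : PowerSeries.constantCoeff G = 0) : IsUnit (deformX θ a G) :=
  PowerSeries.isUnit_iff_constantCoeff.2 ((constantCoeff_deformX θ a hG).symm ▸ isUnit_X θ)

theorem deformX_mul_C (a : K) (G : PowerSeries (fixedField θ)) (b : K) :
    deformX θ a G * PowerSeries.C (SkewLaurent.C θ b) =
      PowerSeries.C (SkewLaurent.C θ (θ b)) * deformX θ a G := by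
  have hcomm : Commute (1 + PowerSeries.C (SkewLaurent.C θ a) * dilate θ G)
      (PowerSeries.C (SkewLaurent.C θ (θ b))) :=
    (Commute.one_left _).add_left
      ((((Commute.all a (θ b)).map (SkewLaurent.C θ)).map PowerSeries.C).mul_left
        (dilate_commute_C θ G _))
  rw [deformX, mul_assoc, ← map_mul, X_mul_C, map_mul, ← mul_assoc, hcomm.eq, mul_assoc]

theorem deformX_pow_orderOf {a : K} {P : (fixedField θ)[X]}
    (hP : P.map (fixedField θ).subtype = normPoly θ a (orderOf θ))
    {G : PowerSeries (fixedField θ)} (hG : Polynomial.aeval G P = 1 + PowerSeries.X) :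
    deformX θ a G ^ orderOf θ =
      PowerSeries.C (SkewLaurent.X θ ^ orderOf θ) + PowerSeries.X := by
  let c : K →+* PowerSeries (SkewLaurent θ) := PowerSeries.C.comp (SkewLaurent.C θ)
  have hcg (b : K) : Commute (c b) (dilate θ G) := (dilate_commute_C θ G _).symm
  have heval : (Polynomial.eval₂RingHom' c (dilate θ G) hcg).comp
      (Polynomial.mapRingHom (fixedField θ).subtype) =
        (dilate θ).comp (Polynomial.aeval (R := fixedField θ) G).toRingHom := by
    refine Polynomial.ringHom_ext (fun b => ?_) ?_
    · simp [c, ← dilate_C]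
    · simp
  have hP' : Polynomial.eval₂RingHom' c (dilate θ G) hcg (normPoly θ a (orderOf θ)) =
      dilate θ (1 + PowerSeries.X) := by
    rw [← hP, ← hG]
    exact DFunLike.congr_fun heval P
  have hXc (b : K) :
      PowerSeries.C (SkewLaurent.X θ) * c b = c (θ b) * PowerSeries.C (SkewLaurent.X θ) := by
    simp only [c, RingHom.comp_apply, ← map_mul, X_mul_C]
  rw [← dilate_one_add_X_mul, ← hP', map_pow]
  exact one_add_mul_mul_pow c hcg (dilate_commute_C θ G _) hXc a (orderOf θ)

theorem exists_deformation (hθ : IsOfFinOrder θ) :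
    ∃ φ : SkewLaurent θ →+* PowerSeries (SkewLaurent θ),
      (∀ b, φ (SkewLaurent.C θ b) = PowerSeries.C (SkewLaurent.C θ b)) ∧
      PowerSeries.constantCoeff (φ (SkewLaurent.X θ)) = SkewLaurent.X θ ∧
      φ (SkewLaurent.X θ ^ orderOf θ) =
        PowerSeries.C (SkewLaurent.X θ ^ orderOf θ) + PowerSeries.X := by
  obtain ⟨a, ha⟩ := exists_sum_range_orderOf_ne_zero hθ
  obtain ⟨P, hP⟩ := exists_map_eq_normPoly (θ := θ) a
  have hcoeff (n : ℕ) : (P.coeff n : K) = (normPoly θ a (orderOf θ)).coeff n := by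
    rw [← hP, Polynomial.coeff_map]
    rfl
  obtain ⟨G, hG0, hG⟩ := exists_aeval_eq_one_add_X P
    (Subtype.ext ((hcoeff 0).trans (normPoly_coeff_zero a _)))
    (fun h => ha (by rw [← normPoly_coeff_one, ← hcoeff, h]; rfl))
  let φ := SkewLaurent.lift θ (PowerSeries.C.comp (SkewLaurent.C θ))
    (isUnit_deformX θ a hG0).unit (deformX_mul_C θ a G)
  have hφX : φ (SkewLaurent.X θ) = deformX θ a G :=
    (SkewLaurent.lift_monomial θ _ _ _ 1 1).trans (by simp)
  refine ⟨φ, fun b => (SkewLaurent.lift_monomial θ _ _ _ 0 b).trans (by simp), ?_, ?_⟩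
  · rw [hφX, constantCoeff_deformX θ a hG0]
  · rw [map_pow, hφX, deformX_pow_orderOf θ hP hG]

end Deformation

section Completion

variable {K : Type*} [Field K] {θ : RingAut K} {N : (fixedField θ)[X]}

section Lift

variable {R : Type*} [Ring R] (φ : SkewLaurent θ →+* PowerSeries R)

theorem coeff_map_eq_zero_of_mem_skewIdeal_pow
    (hφ : PowerSeries.constantCoeff (φ (ofCenter θ N)) = 0) {m k : ℕ} (hk : k < m)
    {f : SkewLaurent θ} (hf : f ∈ skewIdeal θ (N ^ m)) : PowerSeries.coeff k (φ f) = 0 := by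
  obtain ⟨g, rfl⟩ := Ideal.mem_span_singleton'.1 hf
  refine PowerSeries.coeff_of_lt_order _ (lt_of_lt_of_le (Nat.cast_lt.2 hk) ?_)
  rw [map_mul, map_pow, map_pow]
  exact (PowerSeries.le_order_pow_of_constantCoeff_eq_zero m hφ).trans
    (le_add_self.trans (PowerSeries.le_order_mul _ _))

variable (hφ : PowerSeries.constantCoeff (φ (ofCenter θ N)) = 0)

/-- The map induced on `𝒜/N^{k+1}𝒜` by the `k`-th coefficient of `φ`. -/
def coeffQuot (k : ℕ) : SkewQuot θ (N ^ (k + 1)) →+ R :=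
  QuotientAddGroup.lift (skewIdeal θ (N ^ (k + 1))).toAddSubgroup
    ((PowerSeries.coeff (R := R) k).toAddMonoidHom.comp φ.toAddMonoidHom)
    (fun _ hf => coeff_map_eq_zero_of_mem_skewIdeal_pow φ hφ k.lt_succ_self hf)

theorem coeffQuot_apply (x : SkewCompletion θ N) {m k : ℕ} (hk : k < m) {f : SkewLaurent θ}
    (hf : Ideal.Quotient.mk _ f = x.1 m) :
    coeffQuot φ hφ k (x.1 (k + 1)) = PowerSeries.coeff k (φ f) := by
  rw [← x.2 (k + 1) m hk, ← hf]
  rfl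

/-- The extension to the completion of a homomorphism `𝒜 → R[[T]]` which sends `N` to a multiple
of `T`. -/
def completionLift : SkewCompletion θ N →+* PowerSeries R where
  toFun x := PowerSeries.mk fun k => coeffQuot φ hφ k (x.1 (k + 1))
  map_zero' := by
    ext k
    rw [PowerSeries.coeff_mk, coeffQuot_apply φ hφ 0 k.lt_succ_self (map_zero _), map_zero]
  map_one' := by
    ext k
    rw [PowerSeries.coeff_mk, coeffQuot_apply φ hφ 1 k.lt_succ_self (map_one _), map_one]
  map_add' x y := by
    ext k
    rw [map_add, PowerSeries.coeff_mk, PowerSeries.coeff_mk, PowerSeries.coeff_mk, ← map_add]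
    rfl
  map_mul' x y := by
    ext k
    obtain ⟨f, hf⟩ := Ideal.Quotient.mk_surjective (x.1 (k + 1))
    obtain ⟨g, hg⟩ := Ideal.Quotient.mk_surjective (y.1 (k + 1))
    have hfg : Ideal.Quotient.mk _ (f * g) = (x * y).1 (k + 1) :=
      (map_mul _ _ _).trans (congrArg₂ _ hf hg)
    rw [PowerSeries.coeff_mk, coeffQuot_apply φ hφ (x * y) k.lt_succ_self hfg, map_mul,
      PowerSeries.coeff_mul, PowerSeries.coeff_mul]
    refine Finset.sum_congr rfl fun ij hij => ?_
    have hsum := Finset.HasAntidiagonal.mem_antidiagonal.1 hij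
    rw [PowerSeries.coeff_mk, PowerSeries.coeff_mk, coeffQuot_apply φ hφ x (by lia) hf,
      coeffQuot_apply φ hφ y (by lia) hg]

theorem completionLift_toCompletion (f : SkewLaurent θ) :
    completionLift φ hφ (toCompletion θ N f) = φ f := by
  ext k
  exact (PowerSeries.coeff_mk k
    fun k => coeffQuot φ hφ k ((toCompletion θ N f).1 (k + 1))).trans
    (coeffQuot_apply φ hφ (toCompletion θ N f) k.lt_succ_self rfl)

end Lift

theorem nonempty_admissibleMorphism (hθ : IsOfFinOrder θ) {Fs : Type*} [Field Fs]
    [Algebra (fixedField θ) Fs] (z : Fs) : Nonempty (AdmissibleMorphism θ z) := by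
  obtain ⟨φ, hC, hX, hY⟩ := exists_deformation θ hθ
  let N := minpoly (fixedField θ) z
  let φN := (PowerSeries.map (Ideal.Quotient.mk (skewIdeal θ N))).comp φ
  have hconst (f : SkewLaurent θ) : PowerSeries.constantCoeff (φN f) =
      Ideal.Quotient.mk _ (PowerSeries.constantCoeff (φ f)) := by
    simp only [← PowerSeries.coeff_zero_eq_constantCoeff_apply]
    exact PowerSeries.coeff_map (Ideal.Quotient.mk (skewIdeal θ N)) 0 (φ f)
  have hcenter : (PowerSeries.constantCoeff.comp φ).comp (ofCenter θ) = ofCenter θ :=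
    Polynomial.ringHom_ext (fun b => by simp [ofCenter_C, hC]) (by simp [ofCenter_X, hY])
  have hN : PowerSeries.constantCoeff (φN (ofCenter θ N)) = 0 := by
    rw [hconst]
    exact (congrArg _ (DFunLike.congr_fun hcenter N)).trans
      (Ideal.Quotient.eq_zero_iff_mem.2 (Ideal.mem_span_singleton_self _))
  have hlift := completionLift_toCompletion φN hN
  refine ⟨{ toRingHom := completionLift φN hN, map_C := fun b => (hlift _).trans ?_,
            map_X := by rw [hlift, hconst, hX], map_Y := (hlift _).trans ?_ }⟩
  · change PowerSeries.map (Ideal.Quotient.mk (skewIdeal θ N)) (φ _) = _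
    rw [hC, PowerSeries.map_C]
  · change PowerSeries.map (Ideal.Quotient.mk (skewIdeal θ N)) (φ _) = _
    rw [hY, map_add, PowerSeries.map_C, PowerSeries.map_X]

end Completion

end SkewResidue

end

theorem mainTheorem2 {K : Type*} [Field K] (θ : RingAut K) (hθ : IsOfFinOrder θ)
    {Fs : Type*} [Field Fs] [Algebra (SkewResidue.fixedField θ) Fs]
    [IsSepClosure (SkewResidue.fixedField θ) Fs] :
    (∀ z : Fs, z ≠ 0 → Nonempty (SkewResidue.AdmissibleMorphism θ z)) ∧
    ∀ (τ : ∀ z : Fs, z ≠ 0 → SkewResidue.AdmissibleMorphism θ z) (f : SkewResidue.SkewFrac θ),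
      SkewResidue.PolesIn θ Fs f →
      (Function.support (SkewResidue.partialSkewResidue θ hθ τ 0 f)).Finite ∧
      ∑ᶠ z : OnePoint Fs, SkewResidue.partialSkewResidue θ hθ τ 0 f z = 0 :=
  ⟨fun z _ => SkewResidue.nonempty_admissibleMorphism hθ z,
    fun τ _ hf => SkewResidue.hasZeroSum_partialSkewResidue hθ τ hf⟩
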